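/- Let $H$ be a real Hilbert space. All operators are multivalued maps $A\colon H\to 2^H$ with graph $\{(f,g): g\in A(f)\}$ and domain $\{f : A(f)\ne\emptyset\}$; for a non-empty closed convex set $C\subset H$ let $P_C$ be the projection onto $C$. *Definitions.* A strongly continuous non-expansive non-linear resolvent on $C$ is a family of maps $J_\lambda\colon H\to H$, $\lambda\ge 0$, with $J_0=P_C$; $J_\lambda=J_\mu\bigl(\tfrac{\mu}{\lambda}\mathrm{id}_H+(1-\tfrac{\mu}{\lambda})J_\lambda\bigr)$ for $\lambda>0$, $\mu\ge 0$; $\lim_{\lambda\downarrow 0}\|J_\lambda(f)-P_C(f)\|=0$ for all $f\in H$; and $\|J_\lambda(f)-J_\lambda(g)\|\le\|f-g\|$ for all $f,g\in H$, $\lambda\geq 0$. It is generated by an operator $A$ if $A$ is maximal monotone, the graphs of $A_\lambda:=\tfrac1\lambda(\mathrm{id}_H-J_\lambda)$ converge to the graph of $A$ in the sense of Painlevé–Kuratowski in $H\times H$ as $\lambda\downarrow 0$, and $J_\lambda=(\mathrm{id}_H+\lambda A)^{-1}$ for every $\lambda>0$. An operator $A$ is cyclically monotone if $\sum_{i=1}^n\langle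 f_i-f_{i-1},g_i\rangle\ge 0$ for all $n$ and all $g_i\in A(f_i)$, $1\le i\le n$, with $f_0:=f_n$. Its cyclical envelope based at $(f_0,g_0)$ with $g_0\in A(f_0)$ is $$\operatorname{cenv}(A)(f)=\sup\Bigl\{\sum_{i=0}^n\langle f_{i+1}-f_i,g_i\rangle : n\ge 0,\ f_{n+1}=f,\ f_1,\dots,f_n\in H,\ g_i\in A(f_i)\text{ for } 0\le i\le n\Bigr\},$$ where $(f_0,g_0)$ is kept fixed. For $E\colon H\to(-\infty,\infty]$ let $\operatorname{dom}E=\{E<\infty\}$ and let $\partial E$ be the Fréchet subdifferential: $v\in\partial E(f)$ if $f\in\operatorname{dom}E$ and $E(g)-E(f)\ge\langle v,g-f\rangle+o(\|g-f\|)$ as $\operatorname{dom}E\ni g\to f$. *Theorem.* (i) Let $E\colon H\to(-\infty,\infty]$ be proper, convex and lower semicontinuous. For all $\lambda>0$ and $f\in H$ the functional $g\mapsto\tfrac1{2\lambda}\|f-g\|^2+E(g)$ has a unique minimizer $J_\lambda(f)$. Together with $J_0:=P_{\overline{\operatorname{dom}E}}$, the maps $J_\lambda$ form a strongly continuous non-expansive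 non-linear resolvent on $\overline{\operatorname{dom}E}$, generated by $\partial E$, and $\mathrm{id}_H-J_\lambda$ is cyclically monotone for every $\lambda\ge 0$. (ii) Conversely, let $C\subset H$ be non-empty, closed and convex, and let $(J_\lambda)_{\lambda\ge0}$ be a strongly continuous non-expansive non-linear resolvent on $C$ such that $\mathrm{id}_H-J_\lambda$ is cyclically monotone for every $\lambda>0$. Then there exists $f_0\in H$ with $\limsup_{\lambda\downarrow0}\|A_\lambda(f_0)\|<\infty$, where $A_\lambda=\tfrac1\lambda(\mathrm{id}_H-J_\lambda)$. For every such $f_0$, let $E^\lambda$ be the cyclical envelope of $A_\lambda$ based at $(f_0,A_\lambda(f_0))$, and define $E(f):=\lim_{\lambda\downarrow0}E^\lambda(f)$ if $f\in C$ and this limit exists and is $<\infty$, and $E(f):=\infty$ otherwise. Then the limit $\lim_{\lambda\downarrow 0}E^\lambda(f)$ exists in $(-\infty,\infty]$ and equals $E(f)$ for every $f\in H$; the limit is monotone up to additive constants, i.e. there are real constants $c_\lambda$, convergent in $\mathbb R$ as $\lambda\downarrow0$, such that $\lambda\mapsto E^\lambda(f)+c_\lambda$ is non-increasing on $(0,\infty)$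 for every $f\in H$; the functional $E\colon H\to(-\infty,\infty]$ is proper, convex and lower semicontinuous; and $(J_\lambda)$ is generated by $\partial E$. -/

import Mathlib

open Filter Topology

/-- The effective domain of an extended-real functional. -/
def effDomain {H : Type*} (E : H → EReal) : Set H := {f | E f < ⊤}

/-- A proper convex lower semicontinuous functional with values in `(-∞, ∞]`. -/
structure IsProperConvexLsc {H : Type*} [NormedAddCommGroup H] [InnerProductSpace ℝ H]
    (E : H → EReal) : Prop where
  ne_bot : ∀ f, E f ≠ ⊥
  proper : (effDomain E).Nonempty
  convex : ∀ f g : H, ∀ a b : ℝ, 0 < a → 0 < b → a + b = 1 →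
    E (a • f + b • g) ≤ (a : EReal) * E f + (b : EReal) * E g
  lsc : LowerSemicontinuous E

/-- The Fréchet subdifferential: `E g - E f ≥ ⟪v, g - f⟫ + o(‖g - f‖)` as `g → f` in the domain
of `E`. It is empty at the points outside the domain of `E`. -/
def frechetSubdiff {H : Type*} [NormedAddCommGroup H] [InnerProductSpace ℝ H]
    (E : H → EReal) (f : H) : Set H :=
  {v | f ∈ effDomain E ∧ ∀ ε : ℝ, 0 < ε → ∀ᶠ g in 𝓝[effDomain E] f,
    ((inner ℝ v (g - f) - ε * ‖g - f‖ : ℝ) : EReal) ≤ E g - E f}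

/-- The graph of a multivalued operator. -/
def opGraph {H : Type*} (A : H → Set H) : Set (H × H) := {p | p.2 ∈ A p.1}

def IsMonotoneOp {H : Type*} [NormedAddCommGroup H] [InnerProductSpace ℝ H]
    (A : H → Set H) : Prop :=
  ∀ f₁ f₂ g₁ g₂ : H, g₁ ∈ A f₁ → g₂ ∈ A f₂ → 0 ≤ inner ℝ (g₁ - g₂) (f₁ - f₂)

/-- Monotone, and maximal with respect to inclusion of graphs. -/
def IsMaximalMonotoneOp {H : Type*} [NormedAddCommGroup H] [InnerProductSpace ℝ H]
    (A : H → Set H) : Prop :=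
  IsMonotoneOp A ∧ ∀ B : H → Set H, IsMonotoneOp B → opGraph A ⊆ opGraph B → A = B

/-- Cyclical monotonicity: `∑ i = 1..n, ⟪u i - u (i - 1), v i⟫ ≥ 0` whenever `v i ∈ A (u i)` for
`1 ≤ i ≤ n` and `u 0 = u n`. -/
def IsCyclicallyMonotone {H : Type*} [NormedAddCommGroup H] [InnerProductSpace ℝ H]
    (A : H → Set H) : Prop :=
  ∀ (n : ℕ) (u v : ℕ → H), (∀ i < n, v (i + 1) ∈ A (u (i + 1))) → u 0 = u n →
    0 ≤ ∑ i ∈ Finset.range n, inner ℝ (u (i + 1) - u i) (v (i + 1))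

/-- The cyclical envelope of `A` based at `(f₀, g₀)`: the supremum of
`∑ i = 0..n, ⟪u (i + 1) - u i, v i⟫` over all `n ≥ 0` and all chains with `(u 0, v 0) = (f₀, g₀)`,
`v i ∈ A (u i)` for `i ≤ n`, and `u (n + 1) = f`. -/
noncomputable def cyclicalEnvelope {H : Type*} [NormedAddCommGroup H] [InnerProductSpace ℝ H]
    (A : H → Set H) (f₀ g₀ f : H) : EReal :=
  sSup {s : EReal | ∃ (n : ℕ) (u v : ℕ → H), u 0 = f₀ ∧ v 0 = g₀ ∧ u (n + 1) = f ∧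
    (∀ i ≤ n, v i ∈ A (u i)) ∧
    s = ((∑ i ∈ Finset.range (n + 1), inner ℝ (u (i + 1) - u i) (v i) : ℝ) : EReal)}

/-- Outer limit of a family of sets along a filter. -/
noncomputable def outerLimit {X ι : Type*} [PseudoEMetricSpace X] (l : Filter ι)
    (S : ι → Set X) : Set X :=
  {x | liminf (fun i => Metric.infEDist x (S i)) l = 0}

/-- Inner limit of a family of sets along a filter. -/
noncomputable def innerLimit {X ι : Type*} [PseudoEMetricSpace X] (l : Filter ι)
    (S : ι → Set X) : Set X :=
  {x | limsup (fun i => Metric.infEDist x (S i)) l = 0}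

/-- Graph convergence of operators (Painlevé–Kuratowski convergence of the graphs). -/
def GraphTendsto {H ι : Type*} [NormedAddCommGroup H] (A : ι → H → Set H) (l : Filter ι)
    (B : H → Set H) : Prop :=
  outerLimit l (fun i => opGraph (A i)) = opGraph B ∧
    innerLimit l (fun i => opGraph (A i)) = opGraph B

/-- A minimizer of `φ` (arbitrary if there is none). -/
noncomputable def argmin {H : Type*} [Nonempty H] (φ : H → EReal) : H :=
  Classical.epsilon fun g => ∀ h, φ g ≤ φ h

/-- The closest point to `f` in `C` (arbitrary if there is none). -/
noncomputable def convexProj {H : Type*} [NormedAddCommGroup H] (C : Set H) (f : H) : H :=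
  Classical.epsilon fun g => g ∈ C ∧ ∀ h ∈ C, ‖f - g‖ ^ 2 ≤ ‖f - h‖ ^ 2

/-- Strongly continuous non-expansive non-linear resolvents on `C`. Only the values `J lam` with
`0 ≤ lam` matter; the resolvent identity is required wherever `mu / lam` makes sense. -/
structure IsNonlinearResolvent {H : Type*} [NormedAddCommGroup H] [InnerProductSpace ℝ H]
    (C : Set H) (J : ℝ → H → H) : Prop where
  nonempty : C.Nonempty
  isClosed : IsClosed C
  convex : Convex ℝ C
  identity : J 0 = convexProj C
  resolvent_identity : ∀ lam mu : ℝ, 0 < lam → 0 ≤ mu → ∀ f : H,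
    J lam f = J mu ((mu / lam) • f + (1 - mu / lam) • J lam f)
  strong_continuity : ∀ f : H,
    Tendsto (fun lam => ‖J lam f - convexProj C f‖) (𝓝[>] 0) (𝓝 0)
  nonexpansive : ∀ lam : ℝ, 0 ≤ lam → ∀ f g : H, ‖J lam f - J lam g‖ ≤ ‖f - g‖

/-- The single-valued operator `1 - J lam`. -/
def idSubResolvent {H : Type*} [NormedAddCommGroup H] (J : ℝ → H → H) (lam : ℝ) : H → Set H :=
  fun f => {f - J lam f}

/-- The map `(1 / lam) (1 - J lam)`. -/
noncomputable def yosidaMap {H : Type*} [NormedAddCommGroup H] [InnerProductSpace ℝ H]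
    (J : ℝ → H → H) (lam : ℝ) (f : H) : H :=
  (1 / lam) • (f - J lam f)

/-- The map `(1 / lam) (1 - J lam)` as an operator. -/
noncomputable def yosidaOp {H : Type*} [NormedAddCommGroup H] [InnerProductSpace ℝ H]
    (J : ℝ → H → H) (lam : ℝ) : H → Set H :=
  fun f => {yosidaMap J lam f}

/-- `J` is generated by `A`: the operator `A` is maximal monotone, it is the graph limit of
`(1 / lam) (1 - J lam)` as `lam ↓ 0`, and `J lam = (1 + lam A)⁻¹` for every `lam > 0`. -/
structure IsResolventGeneratedBy {H : Type*} [NormedAddCommGroup H] [InnerProductSpace ℝ H]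
    (J : ℝ → H → H) (A : H → Set H) : Prop where
  maximal : IsMaximalMonotoneOp A
  graph_limit : GraphTendsto (fun lam : ℝ => yosidaOp J lam) (𝓝[>] 0) A
  eq_inverse : ∀ lam : ℝ, 0 < lam → ∀ f g : H, J lam g = f ↔ ∃ h ∈ A f, f + lam • h = g

/-- The functional `g ↦ ‖f - g‖² / (2 lam) + E g`. -/
noncomputable def proxFunctional {H : Type*} [NormedAddCommGroup H]
    (E : H → EReal) (lam : ℝ) (f g : H) : EReal :=
  ((1 / (2 * lam) * ‖f - g‖ ^ 2 : ℝ) : EReal) + E g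

/-- The proximal maps of `E` for `lam ≠ 0`, and the projection onto the closure of the domain of
`E` for `lam = 0`. -/
noncomputable def proxResolvent {H : Type*} [NormedAddCommGroup H]
    (E : H → EReal) (lam : ℝ) (f : H) : H :=
  open Classical in
  if lam = 0 then convexProj (closure (effDomain E)) f else argmin (proxFunctional E lam f)

/-- The cyclical envelope of `(1 / lam) (1 - J lam)` based at `f₀` and its image. -/
noncomputable def envelopeEnergy {H : Type*} [NormedAddCommGroup H] [InnerProductSpace ℝ H]
    (J : ℝ → H → H) (f₀ : H) (lam : ℝ) (f : H) : EReal :=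
  cyclicalEnvelope (yosidaOp J lam) f₀ (yosidaMap J lam f₀) f

/-- `limsup ‖(1 / lam) (f₀ - J lam f₀)‖ < ∞` as `lam ↓ 0`. -/
def IsAdmissibleBase {H : Type*} [NormedAddCommGroup H] [InnerProductSpace ℝ H]
    (J : ℝ → H → H) (f₀ : H) : Prop :=
  limsup (fun lam : ℝ => ‖yosidaMap J lam f₀‖ₑ) (𝓝[>] 0) < ⊤

/-- The limit of the envelopes as `lam ↓ 0`, with domain the set of those `f ∈ C` at which the
limit exists and is less than `∞`; the value is `∞` off that domain. -/
noncomputable def limitEnergy {H : Type*} [NormedAddCommGroup H] [InnerProductSpace ℝ H]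
    (C : Set H) (J : ℝ → H → H) (f₀ f : H) : EReal :=
  open Classical in
  if f ∈ C ∧ ∃ a : EReal, a < ⊤ ∧ Tendsto (fun lam => envelopeEnergy J f₀ lam f) (𝓝[>] 0) (𝓝 a)
  then limUnder (𝓝[>] (0 : ℝ)) (fun lam => envelopeEnergy J f₀ lam f)
  else ⊤

open Filter Topology

/-! Both halves pass through one notion, `IsProxFamily E J`: for every λ > 0 the pair (J_λ f, (f -
J_λ f)/λ) lies in the graph of the convex subdifferential ∂E, which for convex E is the Fréchet one
(`mem_frechetSubdiff_iff`). Monotonicity of ∂E makes (1 + λ∂E)⁻¹ single valued, and from this come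
non-expansiveness, the resolvent identity, maximality (Minty) and graph convergence. The Yosida map
is a subgradient of the Moreau envelope M_λ (`moreauEnvelope_add_inner_le`), which gives cyclical
monotonicity. For (i) it remains to produce minimizers by the direct method (`exists_prox`).

For (ii), the resolvent identity shows that all J_λ are resolvents of one operator, A = {(u, v) :
J_1(u + v) = u}. Cyclical monotonicity of id - J_λ along the points u_i + λ v_i, divided by λ and
with λ → 0, makes A cyclically monotone (`sum_chain_le_zero`). Rockafellar's construction, the
cyclical envelope of A, then gives a proper convex lower semicontinuous E with A ⊆ ∂E, so J is the
proximal family of E.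

Since the Yosida map is Lipschitz, its cyclical envelope is exactly M_λ - M_λ(f₀)
(`cyclicalEnvelope_eq_of_potential`). M_λ is non-increasing in λ and tends to E pointwise, including
where E = ∞, and an admissible f₀ lies in dom E. Hence E^λ → E - E(f₀), with c_λ = M_λ(f₀). -/

/-- `v` is a subgradient of `E` at `f` in the sense of convex analysis. -/
def IsSubgradient {H : Type*} [NormedAddCommGroup H] [InnerProductSpace ℝ H]
    (E : H → EReal) (f v : H) : Prop :=
  f ∈ effDomain E ∧ ∀ g ∈ effDomain E, inner ℝ v (g - f) ≤ (E g).toReal - (E f).toReal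

/-! ### Subgradients of convex functionals and existence of proximal points. -/

section ConvexAnalysis

variable {H : Type*} [NormedAddCommGroup H] [InnerProductSpace ℝ H] {E : H → EReal}

theorem IsProperConvexLsc.coe_toReal (hE : IsProperConvexLsc E) {f : H}
    (hf : f ∈ effDomain E) : ((E f).toReal : EReal) = E f :=
  EReal.coe_toReal (ne_of_lt hf) (hE.ne_bot f)

theorem IsProperConvexLsc.toReal_combo_le (hE : IsProperConvexLsc E) {f g : H}
    (hf : f ∈ effDomain E) (hg : g ∈ effDomain E) {a b : ℝ} (ha : 0 < a) (hb : 0 < b)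
    (hab : a + b = 1) :
    a • f + b • g ∈ effDomain E ∧
      (E (a • f + b • g)).toReal ≤ a * (E f).toReal + b * (E g).toReal := by
  have h := hE.convex f g a b ha hb hab
  rw [← hE.coe_toReal hf, ← hE.coe_toReal hg, ← EReal.coe_mul, ← EReal.coe_mul,
    ← EReal.coe_add] at h
  have hd : a • f + b • g ∈ effDomain E := lt_of_le_of_lt h (EReal.coe_lt_top _)
  refine ⟨hd, ?_⟩
  rw [← hE.coe_toReal hd] at h
  exact_mod_cast h

theorem IsProperConvexLsc.convex_effDomain (hE : IsProperConvexLsc E) :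
    Convex ℝ (effDomain E) := by
  rw [convex_iff_forall_pos]
  intro x hx y hy a b ha hb hab
  exact (hE.toReal_combo_le hx hy ha hb hab).1

/-- A proper convex lower semicontinuous functional decreases at most linearly. -/
theorem IsProperConvexLsc.exists_linear_lower_bound (hE : IsProperConvexLsc E) (x : H) :
    ∃ a b : ℝ, 0 ≤ b ∧ ∀ g ∈ effDomain E, a - b * ‖x - g‖ ≤ (E g).toReal := by
  obtain ⟨p, hp⟩ := hE.proper
  have hlt : (((E p).toReal - 1 : ℝ) : EReal) < E p := by
    rw [← hE.coe_toReal hp]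
    exact_mod_cast sub_one_lt (E p).toReal
  obtain ⟨r, hr, hball⟩ := Metric.eventually_nhds_iff_ball.1 (hE.lsc p _ hlt)
  have key : ∀ g ∈ effDomain E, (E p).toReal - 1 - 2 / r * ‖p - g‖ ≤ (E g).toReal := by
    intro g hg
    by_cases hgr : ‖p - g‖ < r
    · have h1 : (((E p).toReal - 1 : ℝ) : EReal) < E g := by
        apply hball
        rwa [Metric.mem_ball, dist_comm, dist_eq_norm]
      rw [← hE.coe_toReal hg] at h1
      have h2 : (E p).toReal - 1 < (E g).toReal := by exact_mod_cast h1
      have : 0 ≤ 2 / r * ‖p - g‖ := by positivity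
      linarith
    · push Not at hgr
      have hd : 0 < ‖p - g‖ := hr.trans_le hgr
      -- The point of the segment from p to g at distance r/2 from p lies in the ball where E > E(p)
      -- - 1; convexity extrapolates this bound linearly to g.
      set t : ℝ := r / (2 * ‖p - g‖) with ht
      have ht0 : 0 < t := by positivity
      have ht1 : t ≤ 1 / 2 := by
        rw [ht, div_le_iff₀ (by positivity)]
        linarith
      obtain ⟨hd1, hle⟩ := hE.toReal_combo_le hp hg (a := 1 - t) (b := t) (by linarith) ht0
        (by ring)
      have h1 : (((E p).toReal - 1 : ℝ) : EReal) < E ((1 - t) • p + t • g) := by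
        apply hball
        have : (1 - t) • p + t • g - p = (-t) • (p - g) := by module
        rw [Metric.mem_ball, dist_eq_norm, this, norm_smul, norm_neg, Real.norm_of_nonneg ht0.le,
          ht]
        have : r / (2 * ‖p - g‖) * ‖p - g‖ = r / 2 := by field_simp
        rw [this]; linarith
      rw [← hE.coe_toReal hd1] at h1
      have h2 : (E p).toReal - 1 < (E ((1 - t) • p + t • g)).toReal := by exact_mod_cast h1
      have h3 : t * ((E p).toReal - (E g).toReal) ≤ 1 := by linarith
      have h4 : (E p).toReal - (E g).toReal ≤ 1 / t := by
        rw [le_div_iff₀ ht0]; linarith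
      have h5 : 1 / t = 2 / r * ‖p - g‖ := by rw [ht]; field_simp
      linarith
  refine ⟨(E p).toReal - 1 - 2 / r * ‖p - x‖, 2 / r, by positivity, fun g hg => ?_⟩
  have h1 := key g hg
  have h2 : ‖p - g‖ ≤ ‖p - x‖ + ‖x - g‖ := norm_sub_le_norm_sub_add_norm_sub p x g
  have h3 := mul_le_mul_of_nonneg_left h2 (show 0 ≤ 2 / r by positivity)
  linarith

theorem IsSubgradient.monotone {f₁ f₂ v₁ v₂ : H} (h₁ : IsSubgradient E f₁ v₁)
    (h₂ : IsSubgradient E f₂ v₂) : 0 ≤ inner ℝ (v₁ - v₂) (f₁ - f₂) := by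
  have h3 := h₁.2 _ h₂.1
  have h4 := h₂.2 _ h₁.1
  have h5 : inner ℝ v₁ (f₂ - f₁) = - inner ℝ v₁ (f₁ - f₂) := by
    rw [← inner_neg_right, neg_sub]
  rw [inner_sub_left]
  linarith

/-- By convexity the difference quotient towards g is largest at g itself, so the local inequality
at one nearby point of the segment, divided by t, becomes global up to ε‖g - f‖. -/
theorem mem_frechetSubdiff_iff (hE : IsProperConvexLsc E) {f v : H} :
    v ∈ frechetSubdiff E f ↔ IsSubgradient E f v := by
  constructor
  · rintro ⟨hf, hv⟩
    refine ⟨hf, fun g hg => ?_⟩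
    refine le_of_forall_pos_le_add fun δ hδ => ?_
    set ε : ℝ := δ / (‖g - f‖ + 1) with hε
    have hε0 : 0 < ε := by positivity
    have hεδ : ε * ‖g - f‖ ≤ δ := by
      rw [hε, div_mul_eq_mul_div, div_le_iff₀ (by positivity)]
      nlinarith [norm_nonneg (g - f)]
    have htend : Tendsto (fun t : ℝ => (1 - t) • f + t • g) (𝓝[>] 0) (𝓝 f) := by
      have : Continuous (fun t : ℝ => (1 - t) • f + t • g) := by fun_prop
      have h := this.tendsto 0
      simp only [sub_zero, one_smul, zero_smul, add_zero] at h
      exact h.mono_left nhdsWithin_le_nhds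
    have hmem : ∀ᶠ t : ℝ in 𝓝[>] 0, t ∈ Set.Ioo (0 : ℝ) 1 := Ioo_mem_nhdsGT one_pos
    have htend' : Tendsto (fun t : ℝ => (1 - t) • f + t • g) (𝓝[>] 0) (𝓝[effDomain E] f) := by
      refine tendsto_nhdsWithin_iff.2 ⟨htend, ?_⟩
      filter_upwards [hmem] with t ht
      exact (hE.toReal_combo_le hf hg (sub_pos.2 ht.2) ht.1 (by ring)).1
    obtain ⟨t, h1, ht⟩ := ((htend'.eventually (hv ε hε0)).and hmem).exists
    obtain ⟨hd, hle⟩ := hE.toReal_combo_le hf hg (sub_pos.2 ht.2) ht.1 (by ring)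
    rw [← hE.coe_toReal hd, ← hE.coe_toReal hf, ← EReal.coe_sub, EReal.coe_le_coe_iff] at h1
    have h2 : (1 - t) • f + t • g - f = t • (g - f) := by module
    rw [h2, inner_smul_right, norm_smul, Real.norm_of_nonneg ht.1.le] at h1
    have h3 : t * (inner ℝ v (g - f) - ε * ‖g - f‖) ≤ t * ((E g).toReal - (E f).toReal) := by
      linarith
    have h4 := le_of_mul_le_mul_left h3 ht.1
    linarith
  · rintro ⟨hf, hv⟩
    refine ⟨hf, fun ε hε => ?_⟩
    filter_upwards [self_mem_nhdsWithin] with g hg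
    rw [← hE.coe_toReal hg, ← hE.coe_toReal hf, ← EReal.coe_sub, EReal.coe_le_coe_iff]
    have := hv g hg
    have : 0 ≤ ε * ‖g - f‖ := by positivity
    linarith

theorem proxFunctional_eq_coe (hE : IsProperConvexLsc E) {lam : ℝ} {f g : H}
    (hg : g ∈ effDomain E) :
    proxFunctional E lam f g = ((1 / (2 * lam) * ‖f - g‖ ^ 2 + (E g).toReal : ℝ) : EReal) := by
  rw [proxFunctional, EReal.coe_add, hE.coe_toReal hg]

theorem proxFunctional_eq_top {H : Type*} [NormedAddCommGroup H] {E : H → EReal} {lam : ℝ}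
    {f g : H} (hg : g ∉ effDomain E) :
    proxFunctional E lam f g = ⊤ := by
  have : E g = ⊤ := by simpa [effDomain] using hg
  rw [proxFunctional, this, EReal.coe_add_top]

/-- The quadratic growth of the proximal functional at a point with the right subgradient. -/
theorem IsSubgradient.prox_growth {lam : ℝ} (hlam : 0 < lam) {f p g : H}
    (hp : IsSubgradient E p ((1 / lam) • (f - p))) (hg : g ∈ effDomain E) :
    1 / (2 * lam) * ‖f - p‖ ^ 2 + (E p).toReal + 1 / (2 * lam) * ‖p - g‖ ^ 2 ≤
      1 / (2 * lam) * ‖f - g‖ ^ 2 + (E g).toReal := by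
  have h := hp.2 g hg
  rw [real_inner_smul_left] at h
  have h1 : ‖f - g‖ ^ 2 = ‖f - p‖ ^ 2 - 2 * inner ℝ (f - p) (g - p) + ‖p - g‖ ^ 2 := by
    have : f - g = (f - p) - (g - p) := by abel
    rw [this, norm_sub_sq_real, norm_sub_rev g p]
  rw [h1]
  have : 1 / (2 * lam) * (‖f - p‖ ^ 2 - 2 * inner ℝ (f - p) (g - p) + ‖p - g‖ ^ 2) =
    1 / (2 * lam) * ‖f - p‖ ^ 2 - 1 / lam * inner ℝ (f - p) (g - p) +
      1 / (2 * lam) * ‖p - g‖ ^ 2 := by field_simp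
  linarith

theorem IsSubgradient.proxFunctional_le (hE : IsProperConvexLsc E) {lam : ℝ} (hlam : 0 < lam)
    {f p : H} (hp : IsSubgradient E p ((1 / lam) • (f - p))) (g : H) :
    proxFunctional E lam f p ≤ proxFunctional E lam f g := by
  by_cases hg : g ∈ effDomain E
  · rw [proxFunctional_eq_coe hE hp.1, proxFunctional_eq_coe hE hg, EReal.coe_le_coe_iff]
    have := hp.prox_growth hlam hg
    have : 0 ≤ 1 / (2 * lam) * ‖p - g‖ ^ 2 := by positivity
    linarith
  · rw [proxFunctional_eq_top hg]
    exact le_top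

theorem IsSubgradient.eq_of_proxFunctional_le (hE : IsProperConvexLsc E) {lam : ℝ}
    (hlam : 0 < lam) {f p g : H} (hp : IsSubgradient E p ((1 / lam) • (f - p)))
    (h : proxFunctional E lam f g ≤ proxFunctional E lam f p) : g = p := by
  by_cases hg : g ∈ effDomain E
  · rw [proxFunctional_eq_coe hE hp.1, proxFunctional_eq_coe hE hg, EReal.coe_le_coe_iff] at h
    have h1 := hp.prox_growth hlam hg
    have h2 : 1 / (2 * lam) * ‖p - g‖ ^ 2 ≤ 0 := by linarith
    have h3 : ‖p - g‖ ^ 2 ≤ 0 := by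
      by_contra hc
      push Not at hc
      have : 0 < 1 / (2 * lam) * ‖p - g‖ ^ 2 := by positivity
      linarith
    have h4 : ‖p - g‖ = 0 := by
      have := sq_nonneg ‖p - g‖
      exact pow_eq_zero_iff (two_ne_zero) |>.1 (le_antisymm h3 this)
    exact (sub_eq_zero.1 (norm_eq_zero.1 h4)).symm
  · rw [proxFunctional_eq_top hg, proxFunctional_eq_coe hE hp.1, top_le_iff] at h
    exact absurd h (EReal.coe_ne_top _)

/-- The Euler–Lagrange inequality: compare p with (1 - t)p + tg, divide by t and let t → 0. -/
theorem isSubgradient_of_forall_proxFunctional_le (hE : IsProperConvexLsc E) {lam : ℝ}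
    (hlam : 0 < lam) {f p : H} (hp : p ∈ effDomain E)
    (h : ∀ g ∈ effDomain E, 1 / (2 * lam) * ‖f - p‖ ^ 2 + (E p).toReal ≤
      1 / (2 * lam) * ‖f - g‖ ^ 2 + (E g).toReal) :
    IsSubgradient E p ((1 / lam) • (f - p)) := by
  refine ⟨hp, fun g hg => ?_⟩
  have key : ∀ t : ℝ, 0 < t → t < 1 → inner ℝ ((1 / lam) • (f - p)) (g - p) ≤
      (E g).toReal - (E p).toReal + t * (1 / (2 * lam) * ‖g - p‖ ^ 2) := by
    intro t ht0 ht1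
    obtain ⟨hd, hle⟩ := hE.toReal_combo_le hp hg (sub_pos.2 ht1) ht0 (by ring)
    have h1 := h _ hd
    have h2 : f - ((1 - t) • p + t • g) = (f - p) - t • (g - p) := by module
    rw [h2, norm_sub_sq_real (f - p), inner_smul_right, norm_smul,
      Real.norm_of_nonneg ht0.le] at h1
    rw [real_inner_smul_left]
    have h3 : 1 / (2 * lam) * (‖f - p‖ ^ 2 - 2 * (t * inner ℝ (f - p) (g - p)) +
        (t * ‖g - p‖) ^ 2) = 1 / (2 * lam) * ‖f - p‖ ^ 2 -
        t * (1 / lam * inner ℝ (f - p) (g - p)) + t * (t * (1 / (2 * lam) * ‖g - p‖ ^ 2)) := by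
      field_simp
    rw [h3] at h1
    refine le_of_mul_le_mul_left ?_ ht0
    linarith
  have htend : Tendsto (fun t : ℝ => (E g).toReal - (E p).toReal +
      t * (1 / (2 * lam) * ‖g - p‖ ^ 2)) (𝓝[>] 0) (𝓝 ((E g).toReal - (E p).toReal)) := by
    have hc : Continuous (fun t : ℝ => (E g).toReal - (E p).toReal +
      t * (1 / (2 * lam) * ‖g - p‖ ^ 2)) := by fun_prop
    have h := hc.tendsto 0
    simp only [zero_mul, add_zero] at h
    exact h.mono_left nhdsWithin_le_nhds
  refine ge_of_tendsto htend ?_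
  filter_upwards [Ioo_mem_nhdsGT one_pos] with t ht
  exact key t ht.1 ht.2

/-- The parallelogram law makes minimizing sequences Cauchy, so strong convergence and lower
semicontinuity suffice. -/
theorem IsProperConvexLsc.exists_prox [CompleteSpace H] (hE : IsProperConvexLsc E) {lam : ℝ}
    (hlam : 0 < lam) (f : H) : ∃ p, IsSubgradient E p ((1 / lam) • (f - p)) := by
  set Φ : H → ℝ := fun g => 1 / (2 * lam) * ‖f - g‖ ^ 2 + (E g).toReal with hΦ
  obtain ⟨a, b, hb, hlow⟩ := hE.exists_linear_lower_bound f
  have hbdd : BddBelow (Φ '' effDomain E) := by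
    -- The minimum over s of s²/(2λ) + a - bs, attained at s = λb.
    refine ⟨a - lam * b ^ 2 / 2, ?_⟩
    rintro _ ⟨g, hg, rfl⟩
    have h1 := hlow g hg
    have h2 : 0 ≤ 1 / (2 * lam) * (‖f - g‖ - lam * b) ^ 2 := by positivity
    have h3 : 1 / (2 * lam) * (‖f - g‖ - lam * b) ^ 2 =
      1 / (2 * lam) * ‖f - g‖ ^ 2 - b * ‖f - g‖ + lam * b ^ 2 / 2 := by field_simp; ring
    simp only [hΦ]
    linarith
  have hne : (Φ '' effDomain E).Nonempty := hE.proper.image _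
  set S := sInf (Φ '' effDomain E) with hS
  have hSle : ∀ g ∈ effDomain E, S ≤ Φ g := fun g hg => csInf_le hbdd ⟨g, hg, rfl⟩
  have hx : ∀ n : ℕ, ∃ g ∈ effDomain E, Φ g < S + 1 / ((n : ℝ) + 1) := by
    intro n
    have hpos : (0 : ℝ) < 1 / ((n : ℝ) + 1) := by positivity
    obtain ⟨_, ⟨g, hg, rfl⟩, h⟩ := exists_lt_of_csInf_lt hne (show S < S + 1 / ((n : ℝ) + 1) by
      linarith)
    exact ⟨g, hg, h⟩
  choose x hxd hxS using hx
  have hpar : ∀ g ∈ effDomain E, ∀ g' ∈ effDomain E,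
      1 / (8 * lam) * ‖g - g'‖ ^ 2 ≤ (Φ g - S) / 2 + (Φ g' - S) / 2 := by
    intro g hg g' hg'
    obtain ⟨hd, hle⟩ := hE.toReal_combo_le hg hg' (a := 1 / 2) (b := 1 / 2) (by norm_num)
      (by norm_num) (by norm_num)
    have h1 := hSle _ hd
    have h2 : f - ((1 / 2 : ℝ) • g + (1 / 2 : ℝ) • g') =
      (1 / 2 : ℝ) • ((f - g) + (f - g')) := by module
    have h3 := parallelogram_law_with_norm ℝ (f - g) (f - g')
    have h4 : f - g - (f - g') = -(g - g') := by abel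
    rw [h4, norm_neg] at h3
    simp only [hΦ] at h1 ⊢
    rw [h2, norm_smul, mul_pow, Real.norm_of_nonneg (by norm_num)] at h1
    have h5 : ‖f - g + (f - g')‖ ^ 2 = 2 * (‖f - g‖ ^ 2 + ‖f - g'‖ ^ 2) - ‖g - g'‖ ^ 2 := by
      nlinarith
    rw [h5] at h1
    have h6 : 1 / (2 * lam) * ((1 / 2) ^ 2 * (2 * (‖f - g‖ ^ 2 + ‖f - g'‖ ^ 2) -
      ‖g - g'‖ ^ 2)) = 1 / (2 * lam) * ‖f - g‖ ^ 2 / 2 + 1 / (2 * lam) * ‖f - g'‖ ^ 2 / 2 -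
      1 / (8 * lam) * ‖g - g'‖ ^ 2 := by field_simp; ring
    linarith
  have hcauchy : CauchySeq x := by
    rw [Metric.cauchySeq_iff']
    intro ε hε
    obtain ⟨N, hN⟩ := exists_nat_one_div_lt (show 0 < 1 / (8 * lam) * ε ^ 2 by positivity)
    refine ⟨N, fun n hn => ?_⟩
    have h1 := hpar _ (hxd n) _ (hxd N)
    have h2 := hxS n
    have h3 := hxS N
    have h4 : 1 / ((n : ℝ) + 1) ≤ 1 / ((N : ℝ) + 1) := Nat.one_div_le_one_div hn
    have h5 : 1 / (8 * lam) * ‖x n - x N‖ ^ 2 < 1 / (8 * lam) * ε ^ 2 := by linarith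
    have h6 := lt_of_mul_lt_mul_left h5 (by positivity)
    rw [dist_eq_norm]
    exact lt_of_pow_lt_pow_left₀ 2 hε.le h6
  obtain ⟨p, hp⟩ := cauchySeq_tendsto_of_complete hcauchy
  have hT : Tendsto (fun n : ℕ => S + 1 / ((n : ℝ) + 1) - 1 / (2 * lam) * ‖f - x n‖ ^ 2) atTop
      (𝓝 (S + 0 - 1 / (2 * lam) * ‖f - p‖ ^ 2)) :=
    (tendsto_const_nhds.add tendsto_one_div_add_atTop_nhds_zero_nat).sub
      (((tendsto_const_nhds.sub hp).norm.pow 2).const_mul _)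
  have hle : E p ≤ ((S + 0 - 1 / (2 * lam) * ‖f - p‖ ^ 2 : ℝ) : EReal) := by
    by_contra hc
    push Not at hc
    obtain ⟨t, ht1, ht2⟩ := EReal.lt_iff_exists_real_btwn.1 hc
    have h1 := hp.eventually (hE.lsc p _ ht2)
    have h2 := hT.eventually (gt_mem_nhds (EReal.coe_lt_coe_iff.1 ht1))
    obtain ⟨n, h3, h4⟩ := (h1.and h2).exists
    rw [← hE.coe_toReal (hxd n), gt_iff_lt, EReal.coe_lt_coe_iff] at h3
    have h5 := hxS n
    simp only [hΦ] at h5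
    linarith
  have hpd : p ∈ effDomain E := lt_of_le_of_lt hle (EReal.coe_lt_top _)
  refine ⟨p, isSubgradient_of_forall_proxFunctional_le hE hlam hpd fun g hg => ?_⟩
  rw [← hE.coe_toReal hpd, EReal.coe_le_coe_iff] at hle
  have := hSle g hg
  simp only [hΦ] at this
  linarith

end ConvexAnalysis

/-! ### Projections onto closed convex sets. -/

section Projection

variable {H : Type*} [NormedAddCommGroup H] [InnerProductSpace ℝ H] [CompleteSpace H] {C : Set H}

theorem convexProj_spec (hne : C.Nonempty) (hcl : IsClosed C) (f : H) (hco : Convex ℝ C) :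
    convexProj C f ∈ C ∧ ∀ h ∈ C, ‖f - convexProj C f‖ ^ 2 ≤ ‖f - h‖ ^ 2 := by
  have hex : ∃ g, g ∈ C ∧ ∀ h ∈ C, ‖f - g‖ ^ 2 ≤ ‖f - h‖ ^ 2 := by
    obtain ⟨v, hv, hmin⟩ := exists_norm_eq_iInf_of_complete_convex hne hcl.isComplete hco f
    refine ⟨v, hv, fun h hh => ?_⟩
    gcongr
    rw [hmin]
    exact ciInf_le ⟨0, by rintro _ ⟨w, rfl⟩; exact norm_nonneg _⟩ (⟨h, hh⟩ : C)
  exact Classical.epsilon_spec hex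

theorem inner_sub_convexProj_le_zero (hne : C.Nonempty) (hcl : IsClosed C) (hco : Convex ℝ C)
    (f : H) {h : H} (hh : h ∈ C) : inner ℝ (f - convexProj C f) (h - convexProj C f) ≤ 0 := by
  obtain ⟨hP, hmin⟩ := convexProj_spec hne hcl f hco
  refine (norm_eq_iInf_iff_real_inner_le_zero hco hP).1 ?_ h hh
  have : Nonempty C := hne.to_subtype
  refine le_antisymm (le_ciInf fun w => ?_) ?_
  · exact (sq_le_sq₀ (norm_nonneg _) (norm_nonneg _)).1 (hmin w w.2)
  · exact ciInf_le ⟨0, by rintro _ ⟨w, rfl⟩; exact norm_nonneg _⟩ (⟨_, hP⟩ : C)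

theorem convexProj_eq_self (hne : C.Nonempty) (hcl : IsClosed C) (hco : Convex ℝ C)
    {f : H} (hf : f ∈ C) : convexProj C f = f := by
  have := inner_sub_convexProj_le_zero hne hcl hco f hf
  rw [real_inner_self_eq_norm_sq] at this
  have h0 : ‖f - convexProj C f‖ = 0 := by
    exact pow_eq_zero_iff two_ne_zero |>.1 (le_antisymm this (sq_nonneg _))
  exact (sub_eq_zero.1 (norm_eq_zero.1 h0)).symm

/-- Turns near-optimality of h for the distance to C into closeness of h to the projection. -/
theorem norm_sub_convexProj_sq_le (hne : C.Nonempty) (hcl : IsClosed C) (hco : Convex ℝ C)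
    (f : H) {h : H} (hh : h ∈ C) :
    ‖h - convexProj C f‖ ^ 2 ≤ ‖f - h‖ ^ 2 - ‖f - convexProj C f‖ ^ 2 := by
  have h1 := inner_sub_convexProj_le_zero hne hcl hco f hh
  have h2 : f - h = (f - convexProj C f) - (h - convexProj C f) := by abel
  rw [h2, norm_sub_sq_real (f - convexProj C f)]
  linarith

theorem norm_convexProj_sub_le (hne : C.Nonempty) (hcl : IsClosed C) (hco : Convex ℝ C)
    (f g : H) : ‖convexProj C f - convexProj C g‖ ≤ ‖f - g‖ := by
  set p := convexProj C f with hp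
  set q := convexProj C g with hq
  have h1 : inner ℝ (f - p) (q - p) ≤ 0 :=
    inner_sub_convexProj_le_zero hne hcl hco f (convexProj_spec hne hcl g hco).1
  have h2 : inner ℝ (g - q) (p - q) ≤ 0 :=
    inner_sub_convexProj_le_zero hne hcl hco g (convexProj_spec hne hcl f hco).1
  have h3 : inner ℝ (f - p) (q - p) + inner ℝ (g - q) (p - q) =
      ‖p - q‖ ^ 2 - inner ℝ (f - g) (p - q) := by
    rw [← neg_sub p q, inner_neg_right, ← real_inner_self_eq_norm_sq, neg_add_eq_sub,
      ← inner_sub_left, ← inner_sub_left]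
    congr 1; abel
  have h4 := real_inner_le_norm (f - g) (p - q)
  by_contra hc
  push Not at hc
  have h5 : ‖f - g‖ * ‖p - q‖ < ‖p - q‖ * ‖p - q‖ :=
    mul_lt_mul_of_pos_right hc ((norm_nonneg _).trans_lt hc)
  nlinarith

end Projection

/-! ### Cyclical monotonicity from a potential. -/

section Potential

variable {H : Type*} [NormedAddCommGroup H] [InnerProductSpace ℝ H]

/-- An operator contained in the subdifferential of a finite potential is cyclically monotone. -/
theorem isCyclicallyMonotone_of_potential {A : H → Set H} (φ : H → ℝ)
    (h : ∀ f g v, v ∈ A f → φ f + inner ℝ v (g - f) ≤ φ g) : IsCyclicallyMonotone A := by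
  intro n u v hv hu
  have h1 : ∑ i ∈ Finset.range n, (φ (u (i + 1)) - φ (u i)) = 0 := by
    rw [Finset.sum_range_sub (fun i => φ (u i)), hu, sub_self]
  rw [← h1]
  refine Finset.sum_le_sum fun i hi => ?_
  have h2 := h (u (i + 1)) (u i) _ (hv i (Finset.mem_range.1 hi))
  rw [← neg_sub, inner_neg_right, real_inner_comm] at h2
  linarith

end Potential

/-! ### Proximal families: resolvent properties, Moreau envelopes, behaviour as λ ↓ 0. -/

/-- The maps `J lam`, `lam > 0`, are the proximal maps of `E`, in terms of subgradients. -/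
def IsProxFamily {H : Type*} [NormedAddCommGroup H] [InnerProductSpace ℝ H]
    (E : H → EReal) (J : ℝ → H → H) : Prop :=
  ∀ lam : ℝ, 0 < lam → ∀ f : H, IsSubgradient E (J lam f) (yosidaMap J lam f)

/-- The Moreau envelope, when `J` is the family of proximal maps of `E`. -/
noncomputable def moreauEnvelope {H : Type*} [NormedAddCommGroup H]
    (E : H → EReal) (J : ℝ → H → H) (lam : ℝ) (f : H) : ℝ :=
  1 / (2 * lam) * ‖f - J lam f‖ ^ 2 + (E (J lam f)).toReal

section ProxFamily

variable {H : Type*} [NormedAddCommGroup H] [InnerProductSpace ℝ H]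
  {E : H → EReal} {J : ℝ → H → H}

theorem resolvent_add_smul_yosidaMap {lam : ℝ} (hlam : 0 < lam) (f : H) :
    J lam f + lam • yosidaMap J lam f = f := by
  rw [yosidaMap, smul_smul, mul_one_div_cancel hlam.ne', one_smul, add_sub_cancel]

/-- `(1 + lam A)⁻¹` is single valued for a subdifferential `A`. -/
theorem IsProxFamily.eq_of_isSubgradient (hJ : IsProxFamily E J) {lam : ℝ} (hlam : 0 < lam)
    {f v : H} (hv : IsSubgradient E f v) : J lam (f + lam • v) = f := by
  have h := (hJ lam hlam (f + lam • v)).monotone hv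
  set p := J lam (f + lam • v) with hp
  have h1 := resolvent_add_smul_yosidaMap (J := J) hlam (f + lam • v)
  rw [← hp] at h1
  have h2 : yosidaMap J lam (f + lam • v) - v = -(1 / lam) • (p - f) := by
    rw [yosidaMap, ← hp]
    have : v = (1 / lam) • (lam • v) := by
      rw [smul_smul, one_div_mul_cancel hlam.ne', one_smul]
    nth_rewrite 2 [this]
    module
  rw [h2, real_inner_smul_left, real_inner_self_eq_norm_sq] at h
  have h3 : ‖p - f‖ ^ 2 ≤ 0 := by
    by_contra hc
    push Not at hc
    have : 0 < 1 / lam * ‖p - f‖ ^ 2 := by positivity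
    linarith
  have h4 : ‖p - f‖ = 0 := pow_eq_zero_iff two_ne_zero |>.1 (le_antisymm h3 (sq_nonneg _))
  exact sub_eq_zero.1 (norm_eq_zero.1 h4)

/-- Monotonicity yields firm non-expansiveness, ‖Jf - Jg‖² ≤ ⟪f - g, Jf - Jg⟫; Cauchy–Schwarz
finishes. -/
theorem IsProxFamily.norm_sub_le (hJ : IsProxFamily E J) {lam : ℝ} (hlam : 0 < lam) (f g : H) :
    ‖J lam f - J lam g‖ ≤ ‖f - g‖ := by
  have h := (hJ lam hlam f).monotone (hJ lam hlam g)
  have h1 : yosidaMap J lam f - yosidaMap J lam g =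
      (1 / lam) • ((f - g) - (J lam f - J lam g)) := by
    simp only [yosidaMap]; module
  rw [h1, real_inner_smul_left, inner_sub_left, real_inner_self_eq_norm_sq] at h
  have h2 : 0 ≤ inner ℝ (f - g) (J lam f - J lam g) - ‖J lam f - J lam g‖ ^ 2 :=
    nonneg_of_mul_nonneg_right h (by positivity)
  have h4 := real_inner_le_norm (f - g) (J lam f - J lam g)
  by_contra hc
  push Not at hc
  have h5 : ‖f - g‖ * ‖J lam f - J lam g‖ < ‖J lam f - J lam g‖ * ‖J lam f - J lam g‖ :=
    mul_lt_mul_of_pos_right hc ((norm_nonneg _).trans_lt hc)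
  nlinarith

theorem IsProxFamily.resolvent_identity (hJ : IsProxFamily E J) {lam mu : ℝ} (hlam : 0 < lam)
    (hmu : 0 < mu) (f : H) :
    J lam f = J mu ((mu / lam) • f + (1 - mu / lam) • J lam f) := by
  have h := hJ.eq_of_isSubgradient hmu (hJ lam hlam f)
  rw [← h]
  congr 1
  rw [h, yosidaMap, smul_smul, mul_one_div]
  module

/-- With a, b the Yosida values at f, g, the subgradient inequality at J_λ f leaves the surplus λ/2
‖a - b‖² ≥ 0. -/
theorem moreauEnvelope_add_inner_le (hJ : IsProxFamily E J) {lam : ℝ} (hlam : 0 < lam)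
    (f g : H) :
    moreauEnvelope E J lam f + inner ℝ (yosidaMap J lam f) (g - f) ≤
      moreauEnvelope E J lam g := by
  have h := (hJ lam hlam f).2 _ (hJ lam hlam g).1
  have key : ∀ f, moreauEnvelope E J lam f =
      lam / 2 * ‖yosidaMap J lam f‖ ^ 2 + (E (J lam f)).toReal := by
    intro f
    rw [moreauEnvelope, yosidaMap, norm_smul, Real.norm_of_nonneg (by positivity)]
    congr 1
    field_simp
  rw [key, key]
  set a := yosidaMap J lam f with ha
  set b := yosidaMap J lam g with hb
  have h1 : J lam g - J lam f = (g - f) - lam • (b - a) := by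
    nth_rewrite 2 [← resolvent_add_smul_yosidaMap (J := J) hlam f]
    nth_rewrite 2 [← resolvent_add_smul_yosidaMap (J := J) hlam g]
    rw [← ha, ← hb]
    module
  rw [h1, inner_sub_right, inner_smul_right, inner_sub_right a b,
    real_inner_self_eq_norm_sq] at h
  have h2 := norm_sub_sq_real a b
  have h3 : 0 ≤ lam / 2 * ‖a - b‖ ^ 2 := by positivity
  rw [h2] at h3
  linarith

theorem IsProxFamily.isCyclicallyMonotone (hJ : IsProxFamily E J) {lam : ℝ} (hlam : 0 < lam) :
    IsCyclicallyMonotone (idSubResolvent J lam) := by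
  refine isCyclicallyMonotone_of_potential (fun f => lam * moreauEnvelope E J lam f) ?_
  rintro f g v hv
  rw [idSubResolvent, Set.mem_singleton_iff] at hv
  have h := mul_le_mul_of_nonneg_left (moreauEnvelope_add_inner_le hJ hlam f g) hlam.le
  rw [mul_add, yosidaMap, real_inner_smul_left, ← mul_assoc lam (1 / lam),
    mul_one_div_cancel hlam.ne', one_mul] at h
  rw [hv]
  exact h

theorem isCyclicallyMonotone_id_sub_convexProj [CompleteSpace H] {C : Set H} (hne : C.Nonempty)
    (hcl : IsClosed C) (hco : Convex ℝ C) :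
    IsCyclicallyMonotone (fun f => {f - convexProj C f}) := by
  refine isCyclicallyMonotone_of_potential (fun f => ‖f - convexProj C f‖ ^ 2 / 2) ?_
  rintro f g v rfl
  have h := inner_sub_convexProj_le_zero hne hcl hco f (convexProj_spec hne hcl g hco).1
  set p := convexProj C f
  set q := convexProj C g
  have h1 : g - f = (g - q) - (f - p) + (q - p) := by abel
  have h2 := norm_sub_sq_real (f - p) (g - q)
  have h3 := sq_nonneg ‖f - p - (g - q)‖
  rw [h1, inner_add_right, inner_sub_right, real_inner_self_eq_norm_sq]
  linarith

/-- The Moreau envelope minimises the proximal functional. -/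
theorem moreauEnvelope_le (hJ : IsProxFamily E J) {lam : ℝ} (hlam : 0 < lam) (f : H) {g : H}
    (hg : g ∈ effDomain E) :
    moreauEnvelope E J lam f ≤ 1 / (2 * lam) * ‖f - g‖ ^ 2 + (E g).toReal := by
  have h := (hJ lam hlam f).prox_growth hlam hg
  have : 0 ≤ 1 / (2 * lam) * ‖J lam f - g‖ ^ 2 := by positivity
  rw [moreauEnvelope]
  linarith

/-- Testing minimality against a point h of dom E near the projection gives limsup ‖f - J_λ f‖² ≤ ‖f
- h‖², because E decreases at most linearly. -/
theorem IsProxFamily.tendsto_convexProj [CompleteSpace H] (hE : IsProperConvexLsc E)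
    (hJ : IsProxFamily E J) (f : H) :
    Tendsto (fun lam => ‖J lam f - convexProj (closure (effDomain E)) f‖) (𝓝[>] 0) (𝓝 0) := by
  set K := closure (effDomain E) with hK
  have hne : K.Nonempty := hE.proper.closure
  have hcl : IsClosed K := isClosed_closure
  have hco : Convex ℝ K := hE.convex_effDomain.closure
  set P := convexProj K f with hP
  have hPK : P ∈ K := (convexProj_spec hne hcl f hco).1
  obtain ⟨a, b, hb, hlow⟩ := hE.exists_linear_lower_bound f
  have hsq : Tendsto (fun lam => ‖J lam f - P‖ ^ 2) (𝓝[>] 0) (𝓝 0) := by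
    rw [Metric.tendsto_nhds]
    intro ε hε
    have hcont : Tendsto (fun h => ‖f - h‖ ^ 2) (𝓝[effDomain E] P) (𝓝 (‖f - P‖ ^ 2)) := by
      have : Continuous (fun h : H => ‖f - h‖ ^ 2) := by fun_prop
      exact (this.tendsto P).mono_left nhdsWithin_le_nhds
    have : (𝓝[effDomain E] P).NeBot := mem_closure_iff_nhdsWithin_neBot.1 hPK
    obtain ⟨h, hlt, hh⟩ := ((hcont.eventually (gt_mem_nhds
      (show ‖f - P‖ ^ 2 < ‖f - P‖ ^ 2 + ε / 2 by linarith))).and self_mem_nhdsWithin).exists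
    -- This quotient bounds s² = ‖f - J_λ f‖²: the linear term 2λbs is absorbed through 2s ≤ s² + 1.
    have hcont' : Tendsto (fun lam : ℝ => (‖f - h‖ ^ 2 + 2 * lam * ((E h).toReal - a) + lam * b) /
        (1 - lam * b)) (𝓝[>] 0) (𝓝 (‖f - h‖ ^ 2)) := by
      have : ContinuousAt (fun lam : ℝ => (‖f - h‖ ^ 2 + 2 * lam * ((E h).toReal - a) + lam * b) /
          (1 - lam * b)) 0 := by
        refine ContinuousAt.div (by fun_prop) (by fun_prop) (by simp)
      have h1 := this.tendsto
      simp only [mul_zero, zero_mul, add_zero, sub_zero, div_one] at h1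
      exact h1.mono_left nhdsWithin_le_nhds
    have hlb : Tendsto (fun lam : ℝ => lam * b) (𝓝[>] 0) (𝓝 0) := by
      have : Continuous (fun lam : ℝ => lam * b) := by fun_prop
      have h1 := this.tendsto 0
      simp only [zero_mul] at h1
      exact h1.mono_left nhdsWithin_le_nhds
    filter_upwards [self_mem_nhdsWithin, hlb.eventually (gt_mem_nhds one_pos),
      hcont'.eventually (gt_mem_nhds (show ‖f - h‖ ^ 2 < ‖f - P‖ ^ 2 + ε by linarith))]
      with lam hlam h1 h2
    have hlam' : 0 < lam := hlam
    have hJd := (hJ lam hlam f).1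
    have h3 := norm_sub_convexProj_sq_le hne hcl hco f (subset_closure hJd)
    have h4 := moreauEnvelope_le hJ hlam f hh
    have h5 := hlow _ hJd
    rw [moreauEnvelope] at h4
    set s := ‖f - J lam f‖ with hs
    have h6 : s ^ 2 + 2 * lam * (E (J lam f)).toReal ≤
        ‖f - h‖ ^ 2 + 2 * lam * (E h).toReal := by
      have := mul_le_mul_of_nonneg_left h4 (show 0 ≤ 2 * lam by positivity)
      field_simp at this
      linarith
    have h7 : s ^ 2 ≤ (‖f - h‖ ^ 2 + 2 * lam * ((E h).toReal - a) + lam * b) /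
        (1 - lam * b) := by
      rw [le_div_iff₀ (by linarith)]
      have h8 := mul_le_mul_of_nonneg_left h5 (show 0 ≤ 2 * lam by positivity)
      have h9 : 0 ≤ lam * b * (s - 1) ^ 2 := by positivity
      linarith
    rw [Real.dist_eq, sub_zero, abs_of_nonneg (sq_nonneg _)]
    linarith
  have := hsq.sqrt
  simpa [Real.sqrt_sq (norm_nonneg _)] using this

end ProxFamily

/-! ### Maximal monotonicity and graph convergence for proximal families. -/

section ProxFamily

variable {H : Type*} [NormedAddCommGroup H] [InnerProductSpace ℝ H]
  {E : H → EReal} {J : ℝ → H → H}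

theorem IsProxFamily.resolvent_eq_iff (hJ : IsProxFamily E J) {lam : ℝ} (hlam : 0 < lam)
    (f g : H) : J lam g = f ↔ ∃ h, IsSubgradient E f h ∧ f + lam • h = g := by
  constructor
  · rintro rfl
    exact ⟨_, hJ lam hlam g, resolvent_add_smul_yosidaMap hlam g⟩
  · rintro ⟨h, hh, rfl⟩
    exact hJ.eq_of_isSubgradient hlam hh

theorem IsProxFamily.isSubgradient_of_eq (hJ : IsProxFamily E J) {f v : H}
    (h : J 1 (f + v) = f) : IsSubgradient E f v := by
  have h1 := hJ 1 one_pos (f + v)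
  rwa [yosidaMap, h, add_sub_cancel_left, one_div_one, one_smul] at h1

/-- Minty's argument: for w ∈ B f, the resolvent at f + w gives a pair in ∂E with the same sum f +
w, and monotonicity of B forces the two pairs to coincide. -/
theorem IsProxFamily.isMaximalMonotoneOp (hE : IsProperConvexLsc E) (hJ : IsProxFamily E J) :
    IsMaximalMonotoneOp (frechetSubdiff E) := by
  refine ⟨fun f₁ f₂ g₁ g₂ h₁ h₂ => ?_, fun B hB hsub => ?_⟩
  · rw [mem_frechetSubdiff_iff hE] at h₁ h₂
    exact h₁.monotone h₂
  · refine funext fun f => Set.Subset.antisymm (fun w hw => hsub (a := (f, w)) hw) fun w hw => ?_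
    rw [mem_frechetSubdiff_iff hE]
    apply hJ.isSubgradient_of_eq
    have h1 : yosidaMap J 1 (f + w) ∈ B (J 1 (f + w)) :=
      hsub (a := (J 1 (f + w), yosidaMap J 1 (f + w)))
        ((mem_frechetSubdiff_iff hE).2 (hJ 1 one_pos (f + w)))
    have h2 := hB _ _ _ _ hw h1
    have h3 : w - yosidaMap J 1 (f + w) = -(f - J 1 (f + w)) := by
      rw [yosidaMap, one_div_one, one_smul]; abel
    rw [h3, inner_neg_left, real_inner_self_eq_norm_sq] at h2
    have h4 : ‖f - J 1 (f + w)‖ = 0 :=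
      pow_eq_zero_iff two_ne_zero |>.1 (le_antisymm (by linarith) (sq_nonneg _))
    exact (sub_eq_zero.1 (norm_eq_zero.1 h4)).symm

/-- Since J_λ(f + λv) = f, the pair (f + λv, v) lies in the Yosida graph. -/
theorem IsProxFamily.tendsto_infEDist_graph (hJ : IsProxFamily E J) {f v : H}
    (h : IsSubgradient E f v) :
    Tendsto (fun lam => Metric.infEDist (f, v) (opGraph (yosidaOp J lam))) (𝓝[>] 0) (𝓝 0) := by
  have h1 : Tendsto (fun lam : ℝ => edist (f, v) (f + lam • v, v)) (𝓝[>] 0) (𝓝 0) := by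
    have hc : Continuous (fun lam : ℝ => edist (f, v) (f + lam • v, v)) := by fun_prop
    have h2 := hc.tendsto 0
    simp only [zero_smul, add_zero, edist_self] at h2
    exact h2.mono_left nhdsWithin_le_nhds
  refine tendsto_of_tendsto_of_tendsto_of_le_of_le' tendsto_const_nhds h1
    (Eventually.of_forall fun _ => zero_le) ?_
  filter_upwards [self_mem_nhdsWithin] with lam hlam
  have hlam' : (0 : ℝ) < lam := hlam
  refine Metric.infEDist_le_edist_of_mem ?_
  change v ∈ yosidaOp J lam (f + lam • v)
  rw [yosidaOp, Set.mem_singleton_iff, yosidaMap, hJ.eq_of_isSubgradient hlam h,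
    add_sub_cancel_left, smul_smul, one_div_mul_cancel hlam'.ne', one_smul]

/-- If (x, a) in the Yosida graph is near (f, v), then J_λ x = x - λa is near f and J_1(J_λ x + a) =
J_λ x. Continuity of J_1 passes this fixed-point relation to (f, v). -/
theorem IsProxFamily.isSubgradient_of_liminf (hJ : IsProxFamily E J) {f v : H}
    (h : liminf (fun lam => Metric.infEDist (f, v) (opGraph (yosidaOp J lam))) (𝓝[>] 0) = 0) :
    IsSubgradient E f v := by
  apply hJ.isSubgradient_of_eq
  -- The bracket bounds ‖f - J_λ x‖ by ‖f - x‖ + λ‖a‖ with λ < δ; it is counted twice by the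
  -- triangle inequality, and the last δ is ‖v - a‖.
  have key : ∀ δ : ℝ, 0 < δ →
      ‖J 1 (f + v) - f‖ ≤ 2 * (δ + δ * (‖v‖ + δ)) + δ := by
    intro δ hδ
    have h1 : ∃ᶠ lam in 𝓝[>] (0 : ℝ),
        Metric.infEDist (f, v) (opGraph (yosidaOp J lam)) < ENNReal.ofReal δ :=
      frequently_lt_of_liminf_lt (by isBoundedDefault) (by rw [h]; simpa using hδ)
    obtain ⟨lam, h2, hlam⟩ := (h1.and_eventually (Ioo_mem_nhdsGT hδ)).exists
    obtain ⟨⟨x, a⟩, ha, h3⟩ := Metric.infEDist_lt_iff.1 h2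
    have ha' : a = yosidaMap J lam x := ha
    rw [edist_lt_ofReal, Prod.dist_eq, max_lt_iff] at h3
    obtain ⟨h4, h5⟩ := h3
    simp only [dist_eq_norm] at h4 h5
    have h6 : J 1 (J lam x + a) = J lam x := by
      have := hJ.eq_of_isSubgradient one_pos (hJ lam hlam.1 x)
      rwa [one_smul, ← ha'] at this
    have h7 := resolvent_add_smul_yosidaMap (J := J) hlam.1 x
    rw [← ha'] at h7
    have h8 : ‖a‖ ≤ ‖v‖ + δ := by
      have := norm_sub_norm_le a v
      rw [norm_sub_rev] at this
      linarith
    have h9 : ‖f - J lam x‖ ≤ δ + δ * (‖v‖ + δ) := by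
      have e : f - J lam x = (f - x) + lam • a := by
        nth_rewrite 2 [← h7]; abel
      rw [e]
      refine (norm_add_le _ _).trans (add_le_add h4.le ?_)
      rw [norm_smul, Real.norm_of_nonneg hlam.1.le]
      exact mul_le_mul hlam.2.le h8 (norm_nonneg _) hδ.le
    have h10 : ‖J 1 (f + v) - J lam x‖ ≤ ‖f - J lam x‖ + ‖v - a‖ := by
      nth_rewrite 1 [← h6]
      refine (hJ.norm_sub_le one_pos _ _).trans ?_
      rw [add_sub_add_comm]
      exact norm_add_le _ _
    have h11 := norm_sub_le_norm_sub_add_norm_sub (J 1 (f + v)) (J lam x) f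
    rw [norm_sub_rev (J lam x) f] at h11
    linarith
  have htend : Tendsto (fun δ : ℝ => 2 * (δ + δ * (‖v‖ + δ)) + δ) (𝓝[>] 0) (𝓝 0) := by
    have hc : Continuous (fun δ : ℝ => 2 * (δ + δ * (‖v‖ + δ)) + δ) := by fun_prop
    have h2 := hc.tendsto 0
    simp only [add_zero, zero_mul, mul_zero] at h2
    exact h2.mono_left nhdsWithin_le_nhds
  have h12 : ‖J 1 (f + v) - f‖ ≤ 0 := by
    refine ge_of_tendsto htend ?_
    filter_upwards [self_mem_nhdsWithin] with δ hδ using key δ hδ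
  exact sub_eq_zero.1 (norm_le_zero_iff.1 h12)

theorem IsProxFamily.isResolventGeneratedBy (hE : IsProperConvexLsc E) (hJ : IsProxFamily E J) :
    IsResolventGeneratedBy J (frechetSubdiff E) := by
  have hgi : opGraph (frechetSubdiff E) ⊆
      innerLimit (𝓝[>] (0 : ℝ)) (fun lam => opGraph (yosidaOp J lam)) := fun x hx =>
    (hJ.tendsto_infEDist_graph ((mem_frechetSubdiff_iff hE).1 hx)).limsup_eq
  have hio : innerLimit (𝓝[>] (0 : ℝ)) (fun lam => opGraph (yosidaOp J lam)) ⊆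
      outerLimit (𝓝[>] (0 : ℝ)) (fun lam => opGraph (yosidaOp J lam)) := fun x hx =>
    le_antisymm ((liminf_le_limsup).trans_eq hx) (zero_le)
  have hog : outerLimit (𝓝[>] (0 : ℝ)) (fun lam => opGraph (yosidaOp J lam)) ⊆
      opGraph (frechetSubdiff E) := fun x hx =>
    (mem_frechetSubdiff_iff hE).2 (hJ.isSubgradient_of_liminf hx)
  refine ⟨hJ.isMaximalMonotoneOp hE, ⟨hog.antisymm (hgi.trans hio), (hio.trans hog).antisymm hgi⟩,
    fun lam hlam f g => ?_⟩
  simp only [mem_frechetSubdiff_iff hE]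
  exact hJ.resolvent_eq_iff hlam f g

end ProxFamily

/-! ### The proximal resolvent of a given functional: the ingredients of part (i). -/

section ProxResolvent

variable {H : Type*} [NormedAddCommGroup H] [InnerProductSpace ℝ H] [CompleteSpace H]
  {E : H → EReal}

theorem isProxFamily_proxResolvent (hE : IsProperConvexLsc E) :
    IsProxFamily E (proxResolvent E) := by
  intro lam hlam f
  obtain ⟨p, hp⟩ := hE.exists_prox hlam f
  have h1 : ∀ h, proxFunctional E lam f (proxResolvent E lam f) ≤ proxFunctional E lam f h := by
    rw [proxResolvent, if_neg hlam.ne']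
    exact Classical.epsilon_spec (p := fun g => ∀ h, proxFunctional E lam f g ≤
      proxFunctional E lam f h) ⟨p, hp.proxFunctional_le hE hlam⟩
  have h2 := hp.eq_of_proxFunctional_le hE hlam (h1 p)
  rw [yosidaMap, h2]
  exact hp

theorem existsUnique_prox (hE : IsProperConvexLsc E) {lam : ℝ} (hlam : 0 < lam) (f : H) :
    ∃! g : H, ∀ h : H, proxFunctional E lam f g ≤ proxFunctional E lam f h := by
  obtain ⟨p, hp⟩ := hE.exists_prox hlam f
  exact ⟨p, hp.proxFunctional_le hE hlam, fun g hg => hp.eq_of_proxFunctional_le hE hlam (hg p)⟩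

theorem proxResolvent_zero {H : Type*} [NormedAddCommGroup H]
    {E : H → EReal} : proxResolvent E 0 = convexProj (closure (effDomain E)) := by
  funext f
  rw [proxResolvent, if_pos rfl]

theorem isNonlinearResolvent_proxResolvent (hE : IsProperConvexLsc E) :
    IsNonlinearResolvent (closure (effDomain E)) (proxResolvent E) := by
  have hJ := isProxFamily_proxResolvent hE
  have hne : (closure (effDomain E)).Nonempty := hE.proper.closure
  have hco : Convex ℝ (closure (effDomain E)) := hE.convex_effDomain.closure
  refine ⟨hne, isClosed_closure, hco, proxResolvent_zero, fun lam mu hlam hmu f => ?_,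
    hJ.tendsto_convexProj hE, fun lam hlam f g => ?_⟩
  · rcases hmu.eq_or_lt with rfl | hmu
    · rw [proxResolvent_zero, zero_div, zero_smul, zero_add, sub_zero, one_smul,
        convexProj_eq_self hne isClosed_closure hco (subset_closure (hJ lam hlam f).1)]
    · exact hJ.resolvent_identity hlam hmu f
  · rcases hlam.eq_or_lt with rfl | hlam
    · rw [proxResolvent_zero]
      exact norm_convexProj_sub_le hne isClosed_closure hco f g
    · exact hJ.norm_sub_le hlam f g

theorem isCyclicallyMonotone_proxResolvent (hE : IsProperConvexLsc E) {lam : ℝ}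
    (hlam : 0 ≤ lam) : IsCyclicallyMonotone (idSubResolvent (proxResolvent E) lam) := by
  rcases hlam.eq_or_lt with rfl | hlam
  · have : idSubResolvent (proxResolvent E) 0 =
        fun f => {f - convexProj (closure (effDomain E)) f} := by
      funext f
      rw [idSubResolvent, proxResolvent_zero]
    rw [this]
    exact isCyclicallyMonotone_id_sub_convexProj hE.proper.closure isClosed_closure
      hE.convex_effDomain.closure
  · exact (isProxFamily_proxResolvent hE).isCyclicallyMonotone hlam

end ProxResolvent

/-! ### Cyclical envelopes and Rockafellar's construction. -/

section Envelope

variable {H : Type*} [NormedAddCommGroup H] [InnerProductSpace ℝ H]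

/-- Chains of length `n` in the graph of `A` starting at `(p, v)`. -/
def IsGraphChain (A : H → Set H) (p v : H) (n : ℕ) (u w : ℕ → H) : Prop :=
  u 0 = p ∧ w 0 = v ∧ ∀ i ≤ n, w i ∈ A (u i)

/-- The affine function of `f` defined by a chain. -/
noncomputable def chainValue (n : ℕ) (u w : ℕ → H) (f : H) : ℝ :=
  ∑ i ∈ Finset.range n, inner ℝ (u (i + 1) - u i) (w i) + inner ℝ (f - u n) (w n)

/-- Detaching the endpoint f from the chains exhibits the envelope as a supremum of affine functions
whose index set does not depend on f. -/
theorem cyclicalEnvelope_le_iff {A : H → Set H} {p v f : H} {a : EReal} :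
    cyclicalEnvelope A p v f ≤ a ↔
      ∀ n u w, IsGraphChain A p v n u w → ((chainValue n u w f : ℝ) : EReal) ≤ a := by
  rw [cyclicalEnvelope, sSup_le_iff]
  constructor
  · rintro h n u w ⟨hu, hw, hA⟩
    refine h _ ⟨n, Function.update u (n + 1) f, w, ?_, hw, by simp, fun i hi => ?_, ?_⟩
    · rw [Function.update_of_ne (by omega), hu]
    · rw [Function.update_of_ne (by omega)]
      exact hA i hi
    · rw [chainValue, Finset.sum_range_succ, Function.update_self,
        Function.update_of_ne (by omega)]
      congr 2
      refine Finset.sum_congr rfl fun i hi => ?_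
      have := Finset.mem_range.1 hi
      rw [Function.update_of_ne (by omega), Function.update_of_ne (by omega)]
  · rintro h _ ⟨n, u, w, hu, hw, hf, hA, rfl⟩
    have := h n u w ⟨hu, hw, hA⟩
    rwa [chainValue, ← hf, ← Finset.sum_range_succ] at this

theorem chainValue_le_cyclicalEnvelope {A : H → Set H} {p v f : H} {n : ℕ} {u w : ℕ → H}
    (h : IsGraphChain A p v n u w) :
    ((chainValue n u w f : ℝ) : EReal) ≤ cyclicalEnvelope A p v f :=
  cyclicalEnvelope_le_iff.1 le_rfl n u w h

theorem chainValue_combo (n : ℕ) (u w : ℕ → H) (f g : H) {a b : ℝ} (hab : a + b = 1) :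
    chainValue n u w (a • f + b • g) = a * chainValue n u w f + b * chainValue n u w g := by
  have h1 : a • f + b • g - u n = a • (f - u n) + b • (g - u n) := by
    have h2 : u n = (a + b) • u n := by rw [hab, one_smul]
    nth_rewrite 1 [h2]
    module
  simp only [chainValue]
  rw [h1, inner_add_left, real_inner_smul_left, real_inner_smul_left]
  linear_combination (- ∑ i ∈ Finset.range n, inner ℝ (u (i + 1) - u i) (w i)) * hab

/-- Appending (g, z) to a chain gives a competitor at f; this is why A is contained in the
subdifferential of its envelope. -/
theorem cyclicalEnvelope_add_inner_le {A : H → Set H} {p v g z : H} (hz : z ∈ A g) (f : H) :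
    cyclicalEnvelope A p v g ≤ cyclicalEnvelope A p v f - ((inner ℝ z (f - g) : ℝ) : EReal) := by
  rw [cyclicalEnvelope_le_iff]
  rintro n u w ⟨hu, hw, hA⟩
  rw [EReal.le_sub_iff_add_le (by simp) (by simp), ← EReal.coe_add]
  have hch : IsGraphChain A p v (n + 1) (Function.update u (n + 1) g)
      (Function.update w (n + 1) z) := by
    refine ⟨by rw [Function.update_of_ne (by omega), hu],
      by rw [Function.update_of_ne (by omega), hw], fun i hi => ?_⟩
    by_cases hin : i = n + 1
    · rw [hin, Function.update_self, Function.update_self]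
      exact hz
    · rw [Function.update_of_ne hin, Function.update_of_ne hin]
      exact hA i (by omega)
  refine le_trans (le_of_eq ?_) (chainValue_le_cyclicalEnvelope (f := f) hch)
  rw [chainValue, chainValue, Finset.sum_range_succ, Function.update_self, Function.update_self,
    Function.update_of_ne (by omega), Function.update_of_ne (by omega), real_inner_comm z (f - g)]
  congr 3
  refine Finset.sum_congr rfl fun i hi => ?_
  have := Finset.mem_range.1 hi
  rw [Function.update_of_ne (by omega), Function.update_of_ne (by omega),
    Function.update_of_ne (by omega)]

theorem isProperConvexLsc_cyclicalEnvelope {A : H → Set H} {p v : H} (hv : v ∈ A p)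
    (hp : cyclicalEnvelope A p v p < ⊤) :
    IsProperConvexLsc (cyclicalEnvelope A p v) := by
  have hne : ∀ f, cyclicalEnvelope A p v f ≠ ⊥ := by
    intro f
    have hch : IsGraphChain A p v 0 (fun _ => p) (fun _ => v) := ⟨rfl, rfl, fun _ _ => hv⟩
    exact ne_bot_of_le_ne_bot (EReal.coe_ne_bot _) (chainValue_le_cyclicalEnvelope (f := f) hch)
  refine ⟨hne, ⟨p, hp⟩, fun f g a b ha hb hab => ?_, fun f t ht => ?_⟩
  · rw [cyclicalEnvelope_le_iff]
    intro n u w hch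
    rw [chainValue_combo n u w f g hab, EReal.coe_add, EReal.coe_mul, EReal.coe_mul]
    refine add_le_add ?_ ?_
    · exact mul_le_mul_of_nonneg_left (chainValue_le_cyclicalEnvelope hch)
        (EReal.coe_nonneg.2 ha.le)
    · exact mul_le_mul_of_nonneg_left (chainValue_le_cyclicalEnvelope hch)
        (EReal.coe_nonneg.2 hb.le)
  · have h1 := mt cyclicalEnvelope_le_iff.2 (not_le.2 ht)
    push Not at h1
    obtain ⟨n, u, w, hch, hlt⟩ := h1
    have hc : Continuous (fun f => ((chainValue n u w f : ℝ) : EReal)) := by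
      refine continuous_coe_real_ereal.comp ?_
      unfold chainValue
      fun_prop
    filter_upwards [(hc.tendsto f).eventually (lt_mem_nhds hlt)] with g hg
    exact hg.trans_le (chainValue_le_cyclicalEnvelope hch)

/-- The cyclical envelope of a Lipschitz gradient is the potential. -/
theorem cyclicalEnvelope_eq_of_potential {a : H → H} {m : H → ℝ} {K : ℝ}
    (ha : ∀ x y, ‖a x - a y‖ ≤ K * ‖x - y‖)
    (hm : ∀ f g, m f + inner ℝ (a f) (g - f) ≤ m g) (f₀ f : H) :
    cyclicalEnvelope (fun x => {a x}) f₀ (a f₀) f = ((m f - m f₀ : ℝ) : EReal) := by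
  apply le_antisymm
  · refine sSup_le ?_
    rintro _ ⟨n, u, w, hu, hw, hf, hA, rfl⟩
    rw [EReal.coe_le_coe_iff, ← hf, ← hu, ← Finset.sum_range_sub (fun i => m (u i))]
    refine Finset.sum_le_sum fun i hi => ?_
    have h1 : w i = a (u i) := hA i (by have := Finset.mem_range.1 hi; omega)
    have h2 := hm (u i) (u (i + 1))
    rw [h1, real_inner_comm]
    linarith
  -- The chain of n + 1 equal steps on the segment from f₀ to f is a Riemann sum. Each step loses at
  -- most K(‖f - f₀‖/(n + 1))², by the Lipschitz bound and the subgradient inequality at the step's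
  -- endpoint.
  · have key : ∀ n : ℕ, ((m f - m f₀ - K * ‖f - f₀‖ ^ 2 * (1 / ((n : ℝ) + 1)) : ℝ) : EReal) ≤
        cyclicalEnvelope (fun x => {a x}) f₀ (a f₀) f := by
      intro n
      have hn : (0 : ℝ) < (n : ℝ) + 1 := by positivity
      set u : ℕ → H := fun i => f₀ + ((i : ℝ) / ((n : ℝ) + 1)) • (f - f₀) with hu
      have hu0 : u 0 = f₀ := by simp [hu]
      have hu1 : u (n + 1) = f := by
        simp only [hu]
        push_cast
        rw [div_self hn.ne', one_smul, add_sub_cancel]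
      have hstep : ∀ i, u (i + 1) - u i = (1 / ((n : ℝ) + 1)) • (f - f₀) := by
        intro i
        simp only [hu]
        push_cast
        rw [add_div]
        module
      refine le_trans ?_ (le_sSup ⟨n, u, fun i => a (u i), hu0, by simp only [hu0], hu1,
        fun i _ => rfl, rfl⟩)
      rw [EReal.coe_le_coe_iff]
      have h1 : ∀ i ∈ Finset.range (n + 1), m (u (i + 1)) - m (u i) -
          K * ‖f - f₀‖ ^ 2 * (1 / ((n : ℝ) + 1)) * (1 / ((n : ℝ) + 1)) ≤
          inner ℝ (u (i + 1) - u i) (a (u i)) := by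
        intro i _
        have h2 := hm (u (i + 1)) (u i)
        have h3 := ha (u (i + 1)) (u i)
        have h4 := real_inner_le_norm (a (u (i + 1)) - a (u i)) (u (i + 1) - u i)
        have h5 : ‖a (u (i + 1)) - a (u i)‖ * ‖u (i + 1) - u i‖ ≤
            K * ‖u (i + 1) - u i‖ * ‖u (i + 1) - u i‖ :=
          mul_le_mul_of_nonneg_right h3 (norm_nonneg _)
        have h6 : K * ‖u (i + 1) - u i‖ * ‖u (i + 1) - u i‖ =
            K * ‖f - f₀‖ ^ 2 * (1 / ((n : ℝ) + 1)) * (1 / ((n : ℝ) + 1)) := by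
          rw [hstep, norm_smul, Real.norm_of_nonneg (by positivity)]
          ring
        rw [← neg_sub (u (i + 1)), inner_neg_right] at h2
        rw [inner_sub_left] at h4
        rw [real_inner_comm]
        linarith
      have h2 := Finset.sum_le_sum h1
      rw [Finset.sum_sub_distrib, Finset.sum_range_sub (fun i => m (u i)), hu0, hu1,
        Finset.sum_const, Finset.card_range, nsmul_eq_mul] at h2
      refine le_trans (le_of_eq ?_) h2
      push_cast
      field_simp
    have hT : Tendsto (fun n : ℕ => m f - m f₀ - K * ‖f - f₀‖ ^ 2 * (1 / ((n : ℝ) + 1))) atTop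
        (𝓝 (m f - m f₀)) := by
      have := (tendsto_one_div_add_atTop_nhds_zero_nat (𝕜 := ℝ)).const_mul (K * ‖f - f₀‖ ^ 2)
      simpa using this.const_sub (m f - m f₀)
    exact le_of_tendsto' ((continuous_coe_real_ereal.tendsto _).comp hT) key

end Envelope

/-! ### From a cyclically monotone resolvent back to a functional. -/

section Resolvent

variable {H : Type*} [NormedAddCommGroup H] [InnerProductSpace ℝ H]
  {C : Set H} {J : ℝ → H → H}

/-- The resolvent identity with μ = 1. With its counterpart `resolvent_eq_of_resolvent_one` it shows
that every J_λ is the λ-resolvent of the operator read off from J_1. -/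
theorem IsNonlinearResolvent.resolvent_one_yosidaMap (hR : IsNonlinearResolvent C J) {lam : ℝ}
    (hlam : 0 < lam) (f : H) : J 1 (J lam f + yosidaMap J lam f) = J lam f := by
  have h := hR.resolvent_identity lam 1 hlam zero_le_one f
  refine Eq.trans ?_ h.symm
  congr 1
  rw [yosidaMap]
  module

theorem IsNonlinearResolvent.resolvent_eq_of_resolvent_one (hR : IsNonlinearResolvent C J)
    {lam : ℝ} (hlam : 0 < lam) {u v : H} (h : J 1 (u + v) = u) : J lam (u + lam • v) = u := by
  have h1 := hR.resolvent_identity 1 lam one_pos hlam.le (u + v)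
  rw [h] at h1
  refine Eq.trans ?_ h1.symm
  congr 1
  module

theorem IsNonlinearResolvent.sum_chain_le_zero (hR : IsNonlinearResolvent C J)
    (hcyc : ∀ lam : ℝ, 0 < lam → IsCyclicallyMonotone (idSubResolvent J lam))
    (n : ℕ) (u v : ℕ → H) (hv : ∀ i ≤ n, J 1 (u i + v i) = u i) (hu : u (n + 1) = u 0) :
    ∑ i ∈ Finset.range (n + 1), inner ℝ (u (i + 1) - u i) (v i) ≤ 0 := by
  -- Only v 0, …, v n are constrained; this closes the perturbed chain u i + λ v' i.
  set v' : ℕ → H := Function.update v (n + 1) (v 0) with hv'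
  have hv'i : ∀ i ≤ n, v' i = v i := fun i hi => Function.update_of_ne (by omega) _ _
  have hv'n : v' (n + 1) = v 0 := Function.update_self ..
  have key : ∀ lam : ℝ, 0 < lam → ∑ i ∈ Finset.range (n + 1), inner ℝ (u (i + 1) - u i) (v i) ≤
      lam * ∑ i ∈ Finset.range (n + 1), inner ℝ (v' i - v' (i + 1)) (v i) := by
    intro lam hlam
    -- The chain is run backwards because `IsCyclicallyMonotone` pairs each step with the vector at
    -- its end, the envelope with the one at its start.
    have h := hcyc lam hlam (n + 1) (fun i => u (n + 1 - i) + lam • v' (n + 1 - i))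
      (fun i => lam • v' (n + 1 - i)) ?_ ?_
    · rw [← Finset.sum_range_reflect] at h
      have h1 : ∀ i ∈ Finset.range (n + 1),
          inner ℝ (u (n + 1 - (n + 1 - 1 - i + 1)) + lam • v' (n + 1 - (n + 1 - 1 - i + 1)) -
            (u (n + 1 - (n + 1 - 1 - i)) + lam • v' (n + 1 - (n + 1 - 1 - i))))
            (lam • v' (n + 1 - (n + 1 - 1 - i + 1))) =
          lam * (lam * inner ℝ (v' i - v' (i + 1)) (v i) - inner ℝ (u (i + 1) - u i) (v i)) := by
        intro i hi
        have hi' := Finset.mem_range.1 hi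
        have e1 : n + 1 - (n + 1 - 1 - i + 1) = i := by omega
        have e2 : n + 1 - (n + 1 - 1 - i) = i + 1 := by omega
        rw [e1, e2, real_inner_smul_right]
        have e3 : u i + lam • v' i - (u (i + 1) + lam • v' (i + 1)) =
          lam • (v' i - v' (i + 1)) - (u (i + 1) - u i) := by module
        rw [e3, inner_sub_left, real_inner_smul_left, hv'i i (by omega)]
      rw [Finset.sum_congr rfl h1, ← Finset.mul_sum] at h
      have h2 := nonneg_of_mul_nonneg_right h hlam
      rw [Finset.sum_sub_distrib, ← Finset.mul_sum] at h2
      linarith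
    · intro i hi
      have h3 : n + 1 - (i + 1) ≤ n := by omega
      rw [idSubResolvent, Set.mem_singleton_iff]
      rw [hv'i _ h3, hR.resolvent_eq_of_resolvent_one hlam (hv _ h3), add_sub_cancel_left]
    · simp only [tsub_zero, tsub_self]
      rw [hu, hv'n, hv'i 0 (by omega)]
  have htend : Tendsto (fun lam : ℝ =>
      lam * ∑ i ∈ Finset.range (n + 1), inner ℝ (v' i - v' (i + 1)) (v i)) (𝓝[>] 0) (𝓝 0) := by
    have hc : Continuous (fun lam : ℝ =>
      lam * ∑ i ∈ Finset.range (n + 1), inner ℝ (v' i - v' (i + 1)) (v i)) := by fun_prop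
    have h2 := hc.tendsto 0
    simp only [zero_mul] at h2
    exact h2.mono_left nhdsWithin_le_nhds
  refine ge_of_tendsto htend ?_
  filter_upwards [self_mem_nhdsWithin] with lam hlam using key lam hlam

/-- A resolvent of cyclically monotone type consists of proximal maps. -/
theorem IsNonlinearResolvent.exists_isProxFamily (hR : IsNonlinearResolvent C J)
    (hcyc : ∀ lam : ℝ, 0 < lam → IsCyclicallyMonotone (idSubResolvent J lam)) :
    ∃ E : H → EReal, IsProperConvexLsc E ∧ IsProxFamily E J := by
  set A : H → Set H := fun u => {v | J 1 (u + v) = u} with hA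
  have hmem : ∀ lam : ℝ, 0 < lam → ∀ f, yosidaMap J lam f ∈ A (J lam f) := fun lam hlam f =>
    hR.resolvent_one_yosidaMap hlam f
  set p := J 1 0
  set v := yosidaMap J 1 0
  -- Chains ending at the base point are closed, so cyclical monotonicity bounds them; this is the
  -- finiteness needed for properness.
  have hp : cyclicalEnvelope A p v p ≤ 0 := by
    refine sSup_le ?_
    rintro _ ⟨n, u, w, hu, hw, hf, hch, rfl⟩
    exact_mod_cast hR.sum_chain_le_zero hcyc n u w hch (hf.trans hu.symm)
  have hp' : cyclicalEnvelope A p v p < ⊤ := hp.trans_lt EReal.zero_lt_top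
  have hE := isProperConvexLsc_cyclicalEnvelope (hmem 1 one_pos 0) hp'
  have hdom : ∀ g z, z ∈ A g → g ∈ effDomain (cyclicalEnvelope A p v) := by
    intro g z hz
    refine (cyclicalEnvelope_add_inner_le hz p).trans_lt ?_
    rw [← hE.coe_toReal hp', ← EReal.coe_sub]
    exact EReal.coe_lt_top _
  refine ⟨_, hE, fun lam hlam f => ⟨hdom _ _ (hmem lam hlam f), fun g hg => ?_⟩⟩
  have h := cyclicalEnvelope_add_inner_le (p := p) (v := v) (hmem lam hlam f) g
  rw [← hE.coe_toReal hg, ← hE.coe_toReal (hdom _ _ (hmem lam hlam f)), ← EReal.coe_sub,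
    EReal.coe_le_coe_iff] at h
  linarith

/-- Any p in the range of J_1 works: J_λ(p + λv) = p for some v, so non-expansiveness bounds the
Yosida values at p by ‖v‖. -/
theorem IsNonlinearResolvent.exists_isAdmissibleBase (hR : IsNonlinearResolvent C J) :
    ∃ f₀ : H, IsAdmissibleBase J f₀ := by
  set p := J 1 0 with hp
  set v := yosidaMap J 1 0
  refine ⟨p, ?_⟩
  have h1 : ∀ lam : ℝ, 0 < lam → ‖yosidaMap J lam p‖ ≤ ‖v‖ := by
    intro lam hlam
    have h2 := hR.resolvent_eq_of_resolvent_one hlam (hR.resolvent_one_yosidaMap one_pos 0)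
    have h3 := hR.nonexpansive lam hlam.le (p + lam • v) p
    rw [h2, add_sub_cancel_left, norm_smul, Real.norm_of_nonneg hlam.le] at h3
    rw [yosidaMap, norm_smul, Real.norm_of_nonneg (by positivity), one_div, inv_mul_le_iff₀ hlam]
    exact h3
  refine lt_of_le_of_lt (limsup_le_of_le (by isBoundedDefault) (a := ‖v‖ₑ) ?_) enorm_lt_top
  filter_upwards [self_mem_nhdsWithin] with lam hlam
  rw [enorm_le_iff_norm_le]
  exact h1 lam hlam

end Resolvent

/-! ### Limits of Moreau envelopes and identification of the limit energy. -/

section LimitEnergy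

variable {H : Type*} [NormedAddCommGroup H] [InnerProductSpace ℝ H]
  {E : H → EReal} {C : Set H} {J : ℝ → H → H}

theorem tendsto_add_coe {ι : Type*} {l : Filter ι} {x : ι → EReal} {y : ι → ℝ} {a : EReal}
    {b : ℝ} (hx : Tendsto x l (𝓝 a)) (hy : Tendsto y l (𝓝 b)) :
    Tendsto (fun i => x i + (y i : EReal)) l (𝓝 (a + b)) :=
  (EReal.continuousAt_add (p := (a, (b : EReal))) (Or.inr (EReal.coe_ne_bot _))
    (Or.inr (EReal.coe_ne_top _))).tendsto.comp (hx.prodMk_nhds (EReal.tendsto_coe.2 hy))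

theorem effDomain_add_coe {H : Type*} {E : H → EReal} (c : ℝ) :
    effDomain (fun f => E f + (c : EReal)) = effDomain E := by
  ext f
  simp only [effDomain, Set.mem_ofPred_eq, lt_top_iff_ne_top]
  rw [not_iff_not]
  induction E f with
  | bot => simp
  | top => simp
  | coe x => simp [← EReal.coe_add]

theorem IsProperConvexLsc.add_coe (hE : IsProperConvexLsc E) (c : ℝ) :
    IsProperConvexLsc (fun f => E f + (c : EReal)) := by
  refine ⟨fun f => ?_, ?_, fun f g a b ha hb hab => ?_, ?_⟩
  · simp [EReal.add_eq_bot_iff, hE.ne_bot f]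
  · rw [effDomain_add_coe]
    exact hE.proper
  · have h1 : ∀ t : ℝ, 0 < t → ∀ x : EReal, (t : EReal) * (x + c) = t * x + t * c :=
      fun t ht x => EReal.left_distrib_of_nonneg_of_ne_top (EReal.coe_nonneg.2 ht.le)
        (EReal.coe_ne_top _) _ _
    rw [h1 a ha, h1 b hb, add_add_add_comm]
    have h2 : (a : EReal) * c + b * c = c := by
      rw [← EReal.coe_mul, ← EReal.coe_mul, ← EReal.coe_add, ← add_mul, hab, one_mul]
    rw [h2]
    exact add_le_add_left (hE.convex f g a b ha hb hab) _
  · exact hE.lsc.add' lowerSemicontinuous_const fun x => EReal.continuousAt_add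
      (Or.inr (EReal.coe_ne_bot _)) (Or.inr (EReal.coe_ne_top _))

theorem IsProxFamily.add_coe (hE : IsProperConvexLsc E) (hJ : IsProxFamily E J) (c : ℝ) :
    IsProxFamily (fun f => E f + (c : EReal)) J := by
  intro lam hlam f
  obtain ⟨h1, h2⟩ := hJ lam hlam f
  refine ⟨by rwa [effDomain_add_coe], fun g hg => ?_⟩
  rw [effDomain_add_coe] at hg
  dsimp only
  rw [← hE.coe_toReal hg, ← hE.coe_toReal h1, ← EReal.coe_add, ← EReal.coe_add,
    EReal.toReal_coe, EReal.toReal_coe]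
  have := h2 g hg
  linarith

/-- For λ ≤ μ, J_λ f is a competitor at μ, where the quadratic weight is smaller. -/
theorem moreauEnvelope_antitoneOn (hJ : IsProxFamily E J) (f : H) :
    AntitoneOn (fun lam => moreauEnvelope E J lam f) (Set.Ioi 0) := by
  intro lam hlam mu hmu hle
  have hlam' : (0 : ℝ) < lam := hlam
  refine (moreauEnvelope_le hJ hmu f (hJ lam hlam f).1).trans ?_
  dsimp only
  rw [moreauEnvelope]
  gcongr

theorem moreauEnvelope_le_of_mem (hE : IsProperConvexLsc E) (hJ : IsProxFamily E J) {lam : ℝ}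
    (hlam : 0 < lam) (f : H) : ((moreauEnvelope E J lam f : ℝ) : EReal) ≤ E f := by
  by_cases hf : f ∈ effDomain E
  · rw [← hE.coe_toReal hf, EReal.coe_le_coe_iff]
    simpa using moreauEnvelope_le hJ hlam f hf
  · have : E f = ⊤ := by simpa [effDomain] using hf
    rw [this]
    exact le_top

theorem tendsto_moreauEnvelope (hE : IsProperConvexLsc E) (hJ : IsProxFamily E J) (f : H) :
    Tendsto (fun lam => ((moreauEnvelope E J lam f : ℝ) : EReal)) (𝓝[>] 0) (𝓝 (E f)) := by
  refine tendsto_order.2 ⟨fun t' ht' => ?_, fun t ht => ?_⟩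
  · obtain ⟨t, ht1, ht⟩ := EReal.lt_iff_exists_real_btwn.1 ht'
    obtain ⟨r, hr, hball⟩ := Metric.eventually_nhds_iff_ball.1 (hE.lsc f _ ht)
    obtain ⟨a, b, hb, hlow⟩ := hE.exists_linear_lower_bound f
    -- If J_λ f is within r of f, lower semicontinuity applies. Otherwise small λ makes s/(2λ) ≥ b +
    -- K, so the envelope is at least a + rK = a + |t - a| + 1 > t.
    set K : ℝ := (|t - a| + 1) / r with hK
    have hK0 : 0 < K := by positivity
    filter_upwards [Ioo_mem_nhdsGT (show 0 < r / (2 * (b + K)) by positivity)] with lam hlam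
    obtain ⟨hlam, hlam1⟩ := hlam
    refine ht1.trans ?_
    rw [EReal.coe_lt_coe_iff]
    have hd := (hJ lam hlam f).1
    rw [moreauEnvelope]
    by_cases hs : ‖f - J lam f‖ < r
    · have h1 : ((t : ℝ) : EReal) < E (J lam f) := by
        apply hball
        rwa [Metric.mem_ball, dist_comm, dist_eq_norm]
      rw [← hE.coe_toReal hd, EReal.coe_lt_coe_iff] at h1
      have : 0 ≤ 1 / (2 * lam) * ‖f - J lam f‖ ^ 2 := by positivity
      linarith
    · push Not at hs
      have h1 := hlow _ hd
      set s := ‖f - J lam f‖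
      have h2 : b + K ≤ 1 / (2 * lam) * s := by
        rw [lt_div_iff₀ (by positivity)] at hlam1
        rw [one_div, ← div_eq_inv_mul, le_div_iff₀ (by positivity)]
        linarith
      have h3 : r * K ≤ s * (1 / (2 * lam) * s - b) :=
        mul_le_mul hs (by linarith) hK0.le (hr.le.trans hs)
      have h4 : r * K = |t - a| + 1 := by rw [hK]; field_simp
      have h5 := le_abs_self (t - a)
      linarith
  · filter_upwards [self_mem_nhdsWithin] with lam hlam
    exact (moreauEnvelope_le_of_mem hE hJ hlam f).trans_lt ht

theorem norm_yosidaMap_sub_le (hJ : IsProxFamily E J) {lam : ℝ} (hlam : 0 < lam) (x y : H) :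
    ‖yosidaMap J lam x - yosidaMap J lam y‖ ≤ 2 / lam * ‖x - y‖ := by
  have h1 : yosidaMap J lam x - yosidaMap J lam y =
      (1 / lam) • ((x - y) - (J lam x - J lam y)) := by
    simp only [yosidaMap]; module
  rw [h1, norm_smul, Real.norm_of_nonneg (by positivity)]
  have h2 := norm_sub_le (x - y) (J lam x - J lam y)
  have h3 := hJ.norm_sub_le hlam x y
  have h4 := mul_le_mul_of_nonneg_left (h2.trans (add_le_add_right h3 _))
    (show 0 ≤ 1 / lam by positivity)
  refine h4.trans (le_of_eq ?_)
  ring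

theorem envelopeEnergy_eq (hJ : IsProxFamily E J) {lam : ℝ} (hlam : 0 < lam) (f₀ f : H) :
    envelopeEnergy J f₀ lam f =
      ((moreauEnvelope E J lam f - moreauEnvelope E J lam f₀ : ℝ) : EReal) :=
  cyclicalEnvelope_eq_of_potential (norm_yosidaMap_sub_le hJ hlam)
    (moreauEnvelope_add_inner_le hJ hlam) f₀ f

/-- Bounded Yosida values force J_λ f₀ → f₀, while the subgradient inequality against a fixed p ∈
dom E bounds E(J_λ f₀) from above; lower semicontinuity concludes. -/
theorem mem_effDomain_of_isAdmissibleBase (hE : IsProperConvexLsc E) (hJ : IsProxFamily E J)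
    {f₀ : H} (h : IsAdmissibleBase J f₀) : f₀ ∈ effDomain E := by
  obtain ⟨b, hb1, hb2⟩ := exists_between h
  set M : ℝ := b.toReal with hM
  have hbM : ∀ᶠ lam in 𝓝[>] (0 : ℝ), ‖yosidaMap J lam f₀‖ ≤ M := by
    filter_upwards [eventually_lt_of_limsup_lt hb1 (by isBoundedDefault)] with lam h1
    have h2 := ENNReal.toReal_mono hb2.ne h1.le
    simpa using h2
  have hM0 : 0 ≤ M := ENNReal.toReal_nonneg
  have hnorm : ∀ lam : ℝ, 0 < lam → ‖yosidaMap J lam f₀‖ ≤ M → ‖J lam f₀ - f₀‖ ≤ lam * M := by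
    intro lam hlam h1
    have h2 : J lam f₀ - f₀ = -(lam • yosidaMap J lam f₀) := by
      nth_rewrite 2 [← resolvent_add_smul_yosidaMap (J := J) hlam f₀]
      abel
    rw [h2, norm_neg, norm_smul, Real.norm_of_nonneg hlam.le]
    exact mul_le_mul_of_nonneg_left h1 hlam.le
  have htend : Tendsto (fun lam => J lam f₀) (𝓝[>] 0) (𝓝 f₀) := by
    rw [tendsto_iff_norm_sub_tendsto_zero]
    have hT : Tendsto (fun lam : ℝ => lam * M) (𝓝[>] 0) (𝓝 0) := by
      have hc : Continuous (fun lam : ℝ => lam * M) := by fun_prop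
      have h2 := hc.tendsto 0
      simp only [zero_mul] at h2
      exact h2.mono_left nhdsWithin_le_nhds
    refine squeeze_zero' (Eventually.of_forall fun _ => norm_nonneg _) ?_ hT
    filter_upwards [self_mem_nhdsWithin, hbM] with lam hlam h1 using hnorm lam hlam h1
  obtain ⟨p, hp⟩ := hE.proper
  by_contra hc
  have hc' : E f₀ = ⊤ := by simpa [effDomain] using hc
  have h1 := hE.lsc f₀ (((E p).toReal + M * (M + ‖f₀ - p‖) : ℝ) : EReal)
    (by change _ < E f₀; rw [hc']; exact EReal.coe_lt_top _)
  obtain ⟨lam, ⟨h2, h3⟩, h4, h5⟩ := (((htend.eventually h1).and hbM).and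
    (Ioo_mem_nhdsGT one_pos)).exists
  have hd := (hJ lam h4 f₀).1
  rw [← hE.coe_toReal hd, gt_iff_lt, EReal.coe_lt_coe_iff] at h2
  have h6 := (hJ lam h4 f₀).2 p hp
  have h7 := neg_le_of_abs_le (abs_real_inner_le_norm (yosidaMap J lam f₀) (p - J lam f₀))
  have h8 : ‖p - J lam f₀‖ ≤ M + ‖f₀ - p‖ := by
    rw [norm_sub_rev]
    refine (norm_sub_le_norm_sub_add_norm_sub _ f₀ _).trans (add_le_add_left ?_ _)
    refine (hnorm lam h4 h3).trans ?_
    have := mul_le_mul_of_nonneg_right h5.le hM0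
    linarith
  have h9 := mul_le_mul h3 h8 (norm_nonneg _) hM0
  linarith

theorem tendsto_envelopeEnergy (hE : IsProperConvexLsc E) (hJ : IsProxFamily E J) {f₀ : H}
    (hf₀ : Tendsto (fun lam => moreauEnvelope E J lam f₀) (𝓝[>] 0) (𝓝 (E f₀).toReal)) (f : H) :
    Tendsto (fun lam => envelopeEnergy J f₀ lam f) (𝓝[>] 0)
      (𝓝 (E f + ((-(E f₀).toReal : ℝ) : EReal))) := by
  refine (tendsto_add_coe (tendsto_moreauEnvelope hE hJ f) hf₀.neg).congr' ?_
  filter_upwards [self_mem_nhdsWithin] with lam hlam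
  rw [envelopeEnergy_eq hJ hlam, sub_eq_add_neg, EReal.coe_add]

theorem limitEnergy_eq_of_tendsto {f₀ : H} {F : H → EReal}
    (hF : ∀ f, Tendsto (fun lam => envelopeEnergy J f₀ lam f) (𝓝[>] 0) (𝓝 (F f)))
    (hC : effDomain F ⊆ C) : limitEnergy C J f₀ = F := by
  funext f
  by_cases hf : f ∈ effDomain F
  · rw [limitEnergy, if_pos ⟨hC hf, F f, hf, hF f⟩]
    exact (hF f).limUnder_eq
  · rw [limitEnergy, if_neg]
    · simpa [effDomain, eq_comm] using hf
    · rintro ⟨_, a, ha, hta⟩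
      rw [tendsto_nhds_unique hta (hF f)] at ha
      exact hf ha

/-- J_λ f converges both to the projection onto C and to that onto the closure of dom E; the latter
fixes f. -/
theorem IsNonlinearResolvent.effDomain_subset [CompleteSpace H] (hR : IsNonlinearResolvent C J)
    (hE : IsProperConvexLsc E) (hJ : IsProxFamily E J) : effDomain E ⊆ C := by
  intro f hf
  have h1 := tendsto_iff_norm_sub_tendsto_zero.2 (hJ.tendsto_convexProj hE f)
  have h2 := tendsto_iff_norm_sub_tendsto_zero.2 (hR.strong_continuity f)
  have h3 := tendsto_nhds_unique h1 h2
  rw [convexProj_eq_self hE.proper.closure isClosed_closure hE.convex_effDomain.closure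
    (subset_closure hf)] at h3
  rw [h3]
  exact (convexProj_spec hR.nonempty hR.isClosed f hR.convex).1

end LimitEnergy

/-! ### Assembly of both parts. -/

theorem mainTheorem9 {H : Type*} [NormedAddCommGroup H] [InnerProductSpace ℝ H]
    [CompleteSpace H] :
    (∀ E : H → EReal, IsProperConvexLsc E →
      (∀ lam : ℝ, 0 < lam → ∀ f : H,
        ∃! g : H, ∀ h : H, proxFunctional E lam f g ≤ proxFunctional E lam f h) ∧
      IsNonlinearResolvent (closure (effDomain E)) (proxResolvent E) ∧
      IsResolventGeneratedBy (proxResolvent E) (frechetSubdiff E) ∧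
      ∀ lam : ℝ, 0 ≤ lam → IsCyclicallyMonotone (idSubResolvent (proxResolvent E) lam)) ∧
    (∀ (C : Set H) (J : ℝ → H → H), IsNonlinearResolvent C J →
      (∀ lam : ℝ, 0 < lam → IsCyclicallyMonotone (idSubResolvent J lam)) →
      (∃ f₀ : H, IsAdmissibleBase J f₀) ∧
      ∀ f₀ : H, IsAdmissibleBase J f₀ →
        (∀ f : H, Tendsto (fun lam : ℝ => envelopeEnergy J f₀ lam f) (𝓝[>] 0)
          (𝓝 (limitEnergy C J f₀ f))) ∧
        (∃ (c : ℝ → ℝ) (c₀ : ℝ), Tendsto c (𝓝[>] 0) (𝓝 c₀) ∧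
          ∀ f : H, AntitoneOn (fun lam : ℝ => envelopeEnergy J f₀ lam f + (c lam : EReal))
            (Set.Ioi 0)) ∧
        IsProperConvexLsc (limitEnergy C J f₀) ∧
        IsResolventGeneratedBy J (frechetSubdiff (limitEnergy C J f₀))) := by
  refine ⟨fun E hE => ⟨fun lam hlam f => existsUnique_prox hE hlam f,
    isNonlinearResolvent_proxResolvent hE,
    (isProxFamily_proxResolvent hE).isResolventGeneratedBy hE,
    fun lam hlam => isCyclicallyMonotone_proxResolvent hE hlam⟩, fun C J hR hcyc => ?_⟩
  refine ⟨hR.exists_isAdmissibleBase, fun f₀ hf₀ => ?_⟩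
  obtain ⟨E, hE, hJ⟩ := hR.exists_isProxFamily hcyc
  have hd := mem_effDomain_of_isAdmissibleBase hE hJ hf₀
  have hm₀ : Tendsto (fun lam => moreauEnvelope E J lam f₀) (𝓝[>] 0) (𝓝 (E f₀).toReal) := by
    rw [← EReal.tendsto_coe, hE.coe_toReal hd]
    exact tendsto_moreauEnvelope hE hJ f₀
  have hlim := tendsto_envelopeEnergy hE hJ hm₀
  -- Rockafellar's E has its own base point; the limit energy is its translate vanishing at f₀, with
  -- the same subgradients.
  set F : H → EReal := fun f => E f + ((-(E f₀).toReal : ℝ) : EReal) with hF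
  have hFE : IsProperConvexLsc F := hE.add_coe _
  have hFJ : IsProxFamily F J := hJ.add_coe hE _
  rw [limitEnergy_eq_of_tendsto hlim (hR.effDomain_subset hFE hFJ)]
  refine ⟨hlim, ⟨fun lam => moreauEnvelope E J lam f₀, _, hm₀, fun f => ?_⟩, hFE,
    hFJ.isResolventGeneratedBy hFE⟩
  intro lam hlam mu hmu hle
  dsimp only
  rw [envelopeEnergy_eq hJ hlam, envelopeEnergy_eq hJ hmu, ← EReal.coe_add, ← EReal.coe_add,
    sub_add_cancel, sub_add_cancel, EReal.coe_le_coe_iff]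
  exact moreauEnvelope_antitoneOn hJ f hlam hmu hle
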